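/- Let $2^{\omega}$ be the Cantor space with the coin-tossing measure $\mu$, and for $z \in 2^\omega$ let $N_{z\restriction n}$ be the set of all $x \in 2^\omega$ that agree with $z$ on the first $n$ coordinates. Let $\mathcal{K}$ be the Polish space of all compact subsets of $2^\omega$ (including $\emptyset$), with the Vietoris topology. For $K \in \mathcal{K}$ and $z \in 2^\omega$ let $$\mathcal{D}_K(z) = \lim_{n \to \infty} \frac{\mu(K \cap N_{z \restriction n})}{\mu(N_{z \restriction n})}$$ whenever this limit exists. Let $\mathrm{Sld}$ be the set of all solid $K\in\mathcal K$, that is, those for which $\mathcal{D}_K(z)$ exists for every $z$, and let $\mathrm{Rng}_{\mathrm{inj}}$ be the set of all $K \in \mathcal{K}$ such that for all $z_1, z_2 \in 2^\omega$, if $\mathcal{D}_K(z_1)$ and $\mathcal{D}_K(z_2)$ exist and $\mathcal{D}_K(z_1) = \mathcal{D}_K(z_2) \in (0,1)$, then $z_1 = z_2$. Lightface pointclasses on $\mathcal{K} \times (0,1)$ are taken with respect to the standard recursive presentations: a set is $\varSigma^0_1$ if it is a recursively enumerable union of basic open sets, $\varPi^0_1$ if its complement is $\varSigma^0_1$, $\varSigma^1_1$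 if it is the projection of a $\varPi^0_1$ subset of the product with $\omega^\omega$, and $\varPi^1_1$ if its complement is $\varSigma^1_1$. Boldface $\boldsymbol{\Sigma}^1_1$, $\boldsymbol{\Pi}^1_1$ and $\boldsymbol{\Delta}^1_1$ sets are, respectively, the analytic sets, the coanalytic sets, and the sets that are both (equivalently, in Polish spaces, the Borel sets). For $A \subseteq \mathcal{K} \times (0,1)$ and $K \in \mathcal K$ put $A_{(K)} = \{ r \in (0,1) : (K, r) \in A \}$. The set $A$ is universal for a boldface class $\boldsymbol{\Gamma}$ of subsets of $(0,1)$ if $A$ is itself $\boldsymbol\Gamma$ in $\mathcal{K} \times (0,1)$ and the sets $A_{(K)}$ with $K \in \mathcal{K}$ are exactly the $\boldsymbol{\Gamma}$ subsets of $(0,1)$. For $\mathcal{C} \subseteq \mathcal{K}$, the set $A \cap (\mathcal{C} \times (0,1))$ parametrizes $\boldsymbol{\Gamma}$ if the sets $A_{(K)}$ with $K \in \mathcal{C}$ are exactly the $\boldsymbol{\Gamma}$ subsets of $(0,1)$. **Theorem.** Let $\mathcal{U} = \{ (K, r) \in \mathcal{K} \times (0,1) : \exists z \in 2^\omega \ (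 \mathcal{D}_K(z) = r ) \}$ and let $\mathcal{U}^{\complement} = ( \mathcal{K} \times (0,1) ) \setminus \mathcal{U}$. Then: (a) $\mathcal{U}$ is $\varSigma^1_1$ and universal for the $\boldsymbol{\Sigma}^1_1$ subsets of $(0,1)$, and $\mathcal{U}^{\complement}$ is $\varPi^1_1$ and universal for the $\boldsymbol{\Pi}^1_1$ subsets of $(0,1)$. (b) $\mathcal{U} \cap ( \mathrm{Sld} \times (0,1) )$ parametrizes the $\boldsymbol{\Sigma}^1_1$ subsets of $(0,1)$, and $\mathcal{U}^{\complement} \cap ( \mathrm{Sld} \times (0,1) )$ parametrizes the $\boldsymbol{\Pi}^1_1$ subsets of $(0,1)$. (c) $\mathcal{U} \cap ( ( \mathrm{Sld} \cap \mathrm{Rng}_{\mathrm{inj}} ) \times (0,1) )$ parametrizes the $\boldsymbol{\Delta}^1_1$ subsets of $(0,1)$, that is, its Borel subsets; and $\mathcal{U}^{\complement} \cap ( ( \mathrm{Sld} \cap \mathrm{Rng}_{\mathrm{inj}} ) \times (0,1) )$ is $\varPi^1_1$ and also parametrizes the $\boldsymbol{\Delta}^1_1$ subsets of $(0,1)$.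 -/

import Mathlib

open Set Filter Topology MeasureTheory TopologicalSpace

namespace DensityUniversal

/-! ### Basic open sets of sequence spaces -/

/-- The basic open set `N_s` of all infinite sequences extending the finite sequence `s`. -/
def nbhdSeq {α : Type} (s : List α) : Set (ℕ → α) :=
  {x | ∀ (i : ℕ) (h : i < s.length), x i = s[i]}

theorem range_nbhdSeq {α : Type} [Inhabited α] :
    range (nbhdSeq (α := α)) =
      {s : Set (ℕ → α) | ∃ (x : ℕ → α) (n : ℕ), s = PiNat.cylinder x n} := by
  ext S
  constructor
  · rintro ⟨s, rfl⟩
    refine ⟨fun i => s.getD i default, s.length, ?_⟩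
    ext x
    simp only [nbhdSeq, PiNat.cylinder, mem_ofPred_eq]
    refine forall_congr' fun i => forall_congr' fun h => ?_
    rw [List.getD_eq_getElem _ _ h]
  · rintro ⟨x, n, rfl⟩
    refine ⟨List.ofFn fun i : Fin n => x i, ?_⟩
    ext y
    simp [nbhdSeq, PiNat.cylinder]

theorem isTopologicalBasis_nbhdSeq {α : Type} [Inhabited α] [TopologicalSpace α]
    [DiscreteTopology α] : IsTopologicalBasis (range (nbhdSeq (α := α))) := by
  rw [range_nbhdSeq]
  exact PiNat.isTopologicalBasis_cylinders fun _ : ℕ => α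

/-! ### The spaces, and their effective bases -/

/-- The Cantor space of infinite binary sequences, with the product topology. -/
abbrev Cantor : Type := ℕ → Bool

/-- The Baire space of infinite sequences of natural numbers, with the product topology. -/
abbrev Baire : Type := ℕ → ℕ

/-- The hyperspace of all compact subsets of the Cantor space (the empty set included), with the
Vietoris topology. -/
abbrev Hyperspace : Type := Compacts Cantor

/-- The open unit interval, as a topological space. -/
abbrev UnitOpen : Type := Ioo (0 : ℝ) 1

/-- A basis of the topology of `X`, indexed by a type of finitary codes. It is used below only for
the standard bases of the Baire space, of the hyperspace, of the open unit interval, and of their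
finite products. -/
class EffectiveBasis (X : Type) [TopologicalSpace X] where
  Code : Type
  [primcodable : Primcodable Code]
  nbhd : Code → Set X
  isBasis : IsTopologicalBasis (range nbhd)

attribute [reducible, instance] EffectiveBasis.primcodable

/-- The Baire space: the sets `N_s`, coded by the finite sequences `s` of natural numbers. -/
instance baireBasis : EffectiveBasis Baire where
  Code := List ℕ
  primcodable := inferInstance
  nbhd := nbhdSeq
  isBasis := isTopologicalBasis_nbhdSeq

/-- The basic Vietoris open set of all compact `K ⊆ N_{s₁} ∪ ⋯ ∪ N_{sₙ}` that meet each of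
`N_{s₁}, …, N_{sₙ}`. -/
def nbhdHyperspace (L : List (List Bool)) : Set Hyperspace :=
  {K | (K : Set Cantor) ⊆ (⋃ s ∈ L, nbhdSeq s) ∧ ∀ s ∈ L, ((K : Set Cantor) ∩ nbhdSeq s).Nonempty}

theorem isTopologicalBasis_nbhdHyperspace : IsTopologicalBasis (range nbhdHyperspace) := by
  have h := (isTopologicalBasis_nbhdSeq (α := Bool)).compacts
  refine h.isTopologicalBasis_of_exists_subset ?_ ?_
  · rintro _ ⟨L, rfl⟩
    refine h.isOpen ⟨nbhdSeq '' {s | s ∈ L}, ⟨(List.finite_toSet L).image _, ?_⟩, ?_⟩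
    · rintro _ ⟨s, -, rfl⟩
      exact mem_range_self s
    · ext K
      simp [nbhdHyperspace, sUnion_image]
  · rintro _ ⟨u, ⟨hu, huB⟩, rfl⟩ K hK
    obtain ⟨t, rfl⟩ := subset_range_iff_exists_image_eq.1 huB
    obtain ⟨t', -, ht', he⟩ := exists_subset_image_finite_and.1
      ⟨nbhdSeq '' t, subset_rfl, hu, rfl⟩
    rw [he] at hK ⊢
    refine ⟨nbhdHyperspace ht'.toFinset.toList, mem_range_self _, ?_, ?_⟩
    · simpa [nbhdHyperspace, sUnion_image] using hK
    · intro K' hK'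
      simpa [nbhdHyperspace, sUnion_image] using hK'

/-- The hyperspace: basic Vietoris open sets, coded by finite lists of finite binary sequences. -/
instance hyperspaceBasis : EffectiveBasis Hyperspace where
  Code := List (List Bool)
  primcodable := inferInstance
  nbhd := nbhdHyperspace
  isBasis := isTopologicalBasis_nbhdHyperspace

/-- The rational interval `(a / (c + 1), b / (c + 1))`, intersected with `(0, 1)`. -/
def nbhdUnitOpen (p : ℕ × ℕ × ℕ) : Set UnitOpen :=
  {r | (p.1 : ℝ) / (p.2.2 + 1) < (r : ℝ) ∧ (r : ℝ) < (p.2.1 : ℝ) / (p.2.2 + 1)}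

theorem isTopologicalBasis_nbhdUnitOpen : IsTopologicalBasis (range nbhdUnitOpen) := by
  refine isTopologicalBasis_of_isOpen_of_nhds ?_ ?_
  · rintro _ ⟨p, rfl⟩
    exact (isOpen_lt continuous_const continuous_subtype_val).inter
      (isOpen_lt continuous_subtype_val continuous_const)
  · rintro ⟨r, hr0, hr1⟩ U hrU hU
    obtain ⟨ε, hε, hball⟩ := Metric.isOpen_iff.1 hU _ hrU
    obtain ⟨c, hc⟩ := exists_nat_one_div_lt (lt_min hε hr0)
    have hc1 : (0 : ℝ) < c + 1 := by positivity
    have hcε : 1 / ((c : ℝ) + 1) < ε := hc.trans_le (min_le_left _ _)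
    -- `a` is the largest natural number with `a / (c + 1) < r`
    have hpos : 0 < r * (c + 1) := by positivity
    have hceil : 0 < ⌈r * (c + 1)⌉₊ := Nat.ceil_pos.2 hpos
    obtain ⟨a, ha⟩ : ∃ a, ⌈r * (c + 1)⌉₊ = a + 1 := ⟨_, (Nat.succ_pred_eq_of_pos hceil).symm⟩
    have ha1 : (a : ℝ) < r * (c + 1) := Nat.lt_ceil.1 (by omega)
    have ha2 : r * (c + 1) ≤ a + 1 := by
      have := Nat.le_ceil (r * ((c : ℝ) + 1))
      rw [ha] at this
      exact_mod_cast this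
    have hb1 : r * (c + 1) < (⌊r * (c + 1)⌋₊ + 1 : ℕ) := by
      exact_mod_cast Nat.lt_floor_add_one (r * ((c : ℝ) + 1))
    have hb2 : ((⌊r * (c + 1)⌋₊ + 1 : ℕ) : ℝ) ≤ r * (c + 1) + 1 := by
      have := Nat.floor_le hpos.le
      push_cast
      linarith
    refine ⟨_, mem_range_self (a, ⌊r * (c + 1)⌋₊ + 1, c), ⟨?_, ?_⟩, ?_⟩
    · exact (div_lt_iff₀ hc1).2 ha1
    · exact (lt_div_iff₀ hc1).2 hb1
    · rintro ⟨x, hx⟩ ⟨h1, h2⟩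
      have h1' : (a : ℝ) < x * (c + 1) := (div_lt_iff₀ hc1).1 h1
      have h2' : x * (c + 1) < (⌊r * (c + 1)⌋₊ + 1 : ℕ) := (lt_div_iff₀ hc1).1 h2
      have hε' : 1 < ε * (c + 1) := (div_lt_iff₀ hc1).1 hcε
      apply hball
      rw [Metric.mem_ball, Subtype.dist_eq, Real.dist_eq, abs_lt]
      constructor
      · have : (-ε) * (c + 1) < (x - r) * (c + 1) := by linarith
        exact lt_of_mul_lt_mul_right this hc1.le
      · have : (x - r) * (c + 1) < ε * (c + 1) := by linarith
        exact lt_of_mul_lt_mul_right this hc1.le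

/-- The open unit interval: rational intervals, coded by triples of natural numbers. -/
instance unitOpenBasis : EffectiveBasis UnitOpen where
  Code := ℕ × ℕ × ℕ
  primcodable := inferInstance
  nbhd := nbhdUnitOpen
  isBasis := isTopologicalBasis_nbhdUnitOpen

/-- Products: products of basic open sets, coded by pairs of codes. -/
instance prodBasis (X Y : Type) [TopologicalSpace X] [TopologicalSpace Y] [EffectiveBasis X]
    [EffectiveBasis Y] : EffectiveBasis (X × Y) where
  Code := EffectiveBasis.Code X × EffectiveBasis.Code Y
  primcodable := inferInstance
  nbhd c := EffectiveBasis.nbhd c.1 ×ˢ EffectiveBasis.nbhd c.2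
  isBasis := by
    have h := (EffectiveBasis.isBasis (X := X)).prod (EffectiveBasis.isBasis (X := Y))
    rwa [image2_range] at h

/-! ### Lightface pointclasses -/

/-- Lightface `Σ⁰₁` (effectively open): a recursively enumerable union of basic open sets. -/
def LightSigma01 {X : Type} [TopologicalSpace X] [EffectiveBasis X] (A : Set X) : Prop :=
  ∃ W : EffectiveBasis.Code X → Prop, REPred W ∧
    A = {x | ∃ c, W c ∧ x ∈ EffectiveBasis.nbhd c}

/-- Lightface `Π⁰₁` (effectively closed). -/
def LightPi01 {X : Type} [TopologicalSpace X] [EffectiveBasis X] (A : Set X) : Prop :=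
  LightSigma01 Aᶜ

/-- Lightface `Σ¹₁`: the projection of a lightface `Π⁰₁` subset of the product with the Baire
space. -/
def LightSigma11 {X : Type} [TopologicalSpace X] [EffectiveBasis X] (A : Set X) : Prop :=
  ∃ C : Set (X × Baire), LightPi01 C ∧ A = {x | ∃ y : Baire, (x, y) ∈ C}

/-- Lightface `Π¹₁`. -/
def LightPi11 {X : Type} [TopologicalSpace X] [EffectiveBasis X] (A : Set X) : Prop :=
  LightSigma11 Aᶜ

/-! ### Boldface pointclasses, universal sets and parametrizations -/

/-- The coanalytic (boldface `Π¹₁`) sets: the complements of analytic sets. -/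
def Coanalytic {X : Type} [TopologicalSpace X] (A : Set X) : Prop :=
  AnalyticSet Aᶜ

/-- Boldface `Δ¹₁`: both analytic and coanalytic. -/
def BoldDelta11 {X : Type} [TopologicalSpace X] (A : Set X) : Prop :=
  AnalyticSet A ∧ Coanalytic A

/-- The vertical section of `A` at `x`. -/
def vsection {X Y : Type} (A : Set (X × Y)) (x : X) : Set Y :=
  {y | (x, y) ∈ A}

/-- `A ∩ (I × Y)` parametrizes the family `Γ` of subsets of `Y`: its vertical sections at the points
of `I` are exactly the members of `Γ`. -/
def Parametrizes {X Y : Type} (A : Set (X × Y)) (I : Set X) (Γ : Set (Set Y)) : Prop :=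
  {S | ∃ x ∈ I, S = vsection (A ∩ I ×ˢ univ) x} = Γ

/-- `A ⊆ X × Y` is universal for the pointclass `Γ` on `Y`: it is itself in `Γ`, and its vertical
sections are exactly the subsets of `Y` in `Γ`. -/
def IsUniversalFor (Γ : ∀ {Z : Type} [TopologicalSpace Z], Set Z → Prop) {X Y : Type}
    [TopologicalSpace X] [TopologicalSpace Y] (A : Set (X × Y)) : Prop :=
  Γ A ∧ {S | ∃ x : X, S = vsection A x} = {S : Set Y | Γ S}

/-! ### Measure and density on the Cantor space -/

/-- The coin-tossing probability measure on the Cantor space. -/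
noncomputable def coinMeasure : Measure Cantor :=
  Measure.infinitePi fun _ : ℕ => (PMF.uniformOfFintype Bool).toMeasure

/-- The density of `A` at `z` exists and equals `r`, where `PiNat.cylinder z n` is the basic open
set determined by the first `n` entries of `z`. -/
def HasDensity (A : Set Cantor) (z : Cantor) (r : ℝ) : Prop :=
  Tendsto (fun n : ℕ => coinMeasure.real (A ∩ PiNat.cylinder z n) /
    coinMeasure.real (PiNat.cylinder z n)) atTop (𝓝 r)

/-- `z` is blurry for `A`: the density of `A` at `z` does not exist. -/
def Blurry (A : Set Cantor) (z : Cantor) : Prop :=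
  ¬ ∃ r : ℝ, HasDensity A z r

/-- The compact sets that are solid, that is, without blurry points. -/
def Sld : Set Hyperspace :=
  {K | ∀ z : Cantor, ¬ Blurry K z}

/-- The compact sets whose density function attains every value in `(0, 1)` at most once. -/
def RngInj : Set Hyperspace :=
  {K | ∀ (z₁ z₂ : Cantor) (r : ℝ), r ∈ Ioo (0 : ℝ) 1 →
    HasDensity K z₁ r → HasDensity K z₂ r → z₁ = z₂}

/-- The set of all pairs `(K, r)` such that `r ∈ (0, 1)` is the density of `K` at some point. -/
def 𝒰 : Set (Hyperspace × UnitOpen) :=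
  {p | ∃ z : Cantor, HasDensity p.1 z p.2}

end DensityUniversal

/-!
Throughout, the relative measure of a compact set `K` at a node of the binary tree is
`μ(K ∩ N_s) / μ(N_s)`, and the density at `z` is the limit of the relative measures along `z`.

**Realizing densities.** Suppose that a function `r` on finite binary words, with values in `[0, 1)`,
converges along every branch `z`, with limit `g z`. Then some solid compact set has the values of `g`
as its densities in `(0, 1)`, each attained as often as by `g` (`exists_solid_of_tendsto`). Indeed,
a martingale on the binary tree is easily built along a copy of the Cantor space: on this copy, one
alternately reads a bit of `z`, with the same relative measure `t` at both children, and moves from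
`t` to some `t'`, which gives the child outside the copy relative measure `2 * t - t'`. As long as
that number is a dyadic rational of the unit interval, a clopen set can be filled in there, all of
whose densities are `0` or `1`. The constraint `0 ≤ 2 * t - t' ≤ 1` allows `t` and `1 - t` to double
in each move, which suffices to follow `r` to its limit (`track`, `tendsto_track`). The compact set
is the set of all branches on which the martingale does not vanish; its relative measures are given
by the martingale because the copy of the Cantor space is passed to children of which only
half remain active, so that an error would have to halve in each round.

**Analytic and Borel sets.** An analytic subset of `(0, 1)` is a continuous image of the Baire space,
and a Borel subset is a continuous injective image of a closed subset of the Baire space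
(`exists_isClosed_injOn_image`). So let `f` be continuous on a closed set `E` of the Baire space. The
set where a limit such as `g` lies in `(0, 1)` is always `σ`-compact, hence the usual coding
of the Baire space by sequences of zeros and ones is of no use: it has limit points that code
nothing. Instead, every node carries a point `d ∈ E`, which is the limit of the branch that stays at
the node forever, while the children of the node partition the remaining points of the node
according to the place and value by which they leave `d` (`child`, `walk`). In this way, points
of `E` correspond one-to-one to the branches that never reach an empty node (`exists_tracks`,
`Tracks.unique`), and the values `f d` converge along the branches. Empty nodes get the value `0`.
This gives `exists_solid_of_isClosed`.

**Upper bounds.** The sections of `𝒰` are analytic since `𝒰` is. For `K` solid the density is a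
Borel function, and for `K ∈ RngInj` it is injective on the preimage of `(0, 1)`, so that the section
is Borel by the theorem of Lusin and Souslin (`measurableSet_vsection`).

**Lightface classes.** All conditions are written as the existence of an element `y` of the Baire
space that codes `K`, `r`, and Skolem functions for an arithmetical formula, subject to a `Π⁰₁`
condition. The code of `K` tells which cylinders meet `K`. Counting the cylinders of a given length
that meet `K` approximates its relative measures from above (`tendsto_count`), and the counts
obey a recursion that can be demanded of `y` locally; this leaves only inequalities between
natural numbers to be checked (`Settles`, `Oscillates`). The transfer from `Π⁰₁` conditions on
`y` to the effective bases of the spaces is `lightSigma11_of_isPi01`.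
-/

namespace DensityUniversal

/-! ### Relative measures of cylinders -/

/-- The cylinder of all sequences that start with the *reverse* of `u`: finite binary words are
stored with the last entry first, as in `PiNat.res`, so that `b :: u` extends `u` by one entry. -/
def cyl (u : List Bool) : Set Cantor :=
  {x | PiNat.res x u.length = u}

theorem mem_cyl_cons {x : Cantor} {b : Bool} {u : List Bool} :
    x ∈ cyl (b :: u) ↔ x u.length = b ∧ x ∈ cyl u := by
  simp [cyl, PiNat.res_succ]

theorem mem_cyl_nil (x : Cantor) : x ∈ cyl [] := by
  simp [cyl]

theorem cyl_res (z : Cantor) (n : ℕ) : cyl (PiNat.res z n) = PiNat.cylinder z n := by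
  rw [PiNat.cylinder_eq_res]
  simp [cyl]

theorem self_mem_cyl_res (z : Cantor) (n : ℕ) : z ∈ cyl (PiNat.res z n) := by
  simp [cyl]

theorem exists_mem_cyl (u : List Bool) : ∃ x, x ∈ cyl u := by
  induction u with
  | nil => exact ⟨fun _ => false, mem_cyl_nil _⟩
  | cons b u ih =>
    obtain ⟨x, hx⟩ := ih
    refine ⟨Function.update x u.length b, mem_cyl_cons.2 ⟨by simp, ?_⟩⟩
    rw [cyl, mem_ofPred_eq] at hx ⊢
    conv_rhs => rw [← hx]
    refine PiNat.res_eq_res.2 fun i hi => ?_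
    rw [Function.update_of_ne hi.ne]

theorem cyl_eq_union (u : List Bool) : cyl u = cyl (false :: u) ∪ cyl (true :: u) := by
  ext x
  simp only [mem_union, mem_cyl_cons]
  cases x u.length <;> simp

theorem disjoint_cyl (u : List Bool) : Disjoint (cyl (false :: u)) (cyl (true :: u)) := by
  rw [Set.disjoint_left]
  intro x h1 h2
  rw [mem_cyl_cons] at h1 h2
  simp [h1.1] at h2

theorem cyl_eq_cylinder (u : List Bool) : ∃ z, cyl u = PiNat.cylinder z u.length := by
  obtain ⟨z, hz⟩ := exists_mem_cyl u
  refine ⟨z, ?_⟩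
  rw [← cyl_res]
  exact congrArg cyl (Eq.symm hz)

theorem isClopen_cyl (u : List Bool) : IsClopen (cyl u) := by
  obtain ⟨z, hz⟩ := cyl_eq_cylinder u
  rw [hz, PiNat.cylinder_eq_pi]
  exact ⟨isClosed_set_pi fun i _ => isClosed_singleton,
    isOpen_set_pi (Finset.finite_toSet _) fun i _ => isOpen_discrete _⟩

theorem measurableSet_cyl (u : List Bool) : MeasurableSet (cyl u) :=
  (isClopen_cyl u).1.measurableSet

instance : IsProbabilityMeasure coinMeasure := by
  unfold coinMeasure
  infer_instance

theorem coinMeasure_real_cyl (u : List Bool) : coinMeasure.real (cyl u) = (1 / 2) ^ u.length := by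
  obtain ⟨z, hz⟩ := cyl_eq_cylinder u
  rw [hz, PiNat.cylinder_eq_pi, measureReal_def, coinMeasure, Measure.infinitePi_pi]
  · have h : ∀ i, (PMF.uniformOfFintype Bool).toMeasure {z i} = 2⁻¹ := by
      intro i
      rw [PMF.toMeasure_apply_singleton _ _ (measurableSet_singleton _)]
      simp
    simp [h]
  · intro i _
    exact measurableSet_singleton _

/-- The measure of `A` relative to the cylinder of `u`. -/
noncomputable def relMeasure (A : Set Cantor) (u : List Bool) : ℝ :=
  coinMeasure.real (A ∩ cyl u) * 2 ^ u.length

theorem hasDensity_iff {A : Set Cantor} {z : Cantor} {r : ℝ} :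
    HasDensity A z r ↔ Tendsto (fun n => relMeasure A (PiNat.res z n)) atTop (𝓝 r) := by
  unfold HasDensity
  refine iff_of_eq (congrArg (fun f => Tendsto f atTop (𝓝 r)) (funext fun n => ?_))
  rw [relMeasure, ← cyl_res, coinMeasure_real_cyl]
  simp [div_eq_mul_inv]

theorem relMeasure_nonneg (A : Set Cantor) (u : List Bool) : 0 ≤ relMeasure A u := by
  unfold relMeasure
  positivity

theorem relMeasure_of_cyl_subset {A : Set Cantor} {u : List Bool} (h : cyl u ⊆ A) :
    relMeasure A u = 1 := by
  rw [relMeasure, inter_eq_right.2 h, coinMeasure_real_cyl, ← mul_pow]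
  norm_num

theorem relMeasure_of_disjoint {A : Set Cantor} {u : List Bool} (h : Disjoint A (cyl u)) :
    relMeasure A u = 0 := by
  simp [relMeasure, h.inter_eq]

theorem relMeasure_mono {A B : Set Cantor} (h : A ⊆ B) (u : List Bool) :
    relMeasure A u ≤ relMeasure B u := by
  unfold relMeasure
  gcongr
  exact measure_ne_top _ _

theorem relMeasure_le_one (A : Set Cantor) (u : List Bool) : relMeasure A u ≤ 1 :=
  (relMeasure_mono (subset_univ A) u).trans_eq (relMeasure_of_cyl_subset (subset_univ _))

theorem relMeasure_eq {A : Set Cantor} (u : List Bool) :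
    relMeasure A u = (relMeasure A (false :: u) + relMeasure A (true :: u)) / 2 := by
  have h : coinMeasure.real (A ∩ cyl u) =
      coinMeasure.real (A ∩ cyl (false :: u)) + coinMeasure.real (A ∩ cyl (true :: u)) := by
    rw [← measureReal_inter_add_sdiff (s := A ∩ cyl u) (measurableSet_cyl (false :: u))]
    congr 2
    · have : cyl (false :: u) ⊆ cyl u := (cyl_eq_union u).symm ▸ subset_union_left
      rw [inter_assoc, inter_eq_right.2 this]
    · rw [inter_sdiff_assoc, cyl_eq_union u, union_sdiff_left,
        sdiff_eq_left.2 (disjoint_cyl u).symm]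
  simp only [relMeasure, h, List.length_cons, pow_succ]
  ring

/-! ### Realizing a limit on the branches of the binary tree as a density function -/

/-- Dyadic rationals, as real numbers. -/
def IsDyadic (q : ℝ) : Prop :=
  ∃ (d : ℕ) (p : ℤ), q * 2 ^ d = p

theorem IsDyadic.two_mul_sub {q q' : ℝ} (h : IsDyadic q) (h' : IsDyadic q') :
    IsDyadic (2 * q - q') := by
  obtain ⟨d, p, hp⟩ := h
  obtain ⟨d', p', hp'⟩ := h'
  refine ⟨d + d', 2 * p * 2 ^ d' - p' * 2 ^ d, ?_⟩
  push_cast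
  rw [← hp, ← hp']
  ring

theorem isDyadic_intCast (n : ℤ) : IsDyadic n :=
  ⟨0, n, by simp⟩

theorem eq_zero_or_eq_one_of_intCast {q : ℝ} {p : ℤ} (hq : q ∈ Icc (0 : ℝ) 1) (hp : q = p) :
    q = 0 ∨ q = 1 := by
  subst hp
  have h0 : 0 ≤ p := by exact_mod_cast hq.1
  have h1 : p ≤ 1 := by exact_mod_cast hq.2
  have : p = 0 ∨ p = 1 := by omega
  exact_mod_cast this

/-- Follows the target `r` along the binary tree, restricted to the moves `t ↦ t'` for which
`2 * t - t'` remains in the unit interval. -/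
noncomputable def track (r : List Bool → ℝ) : List Bool → ℝ
  | [] => r []
  | b :: w => max (2 * track r w - 1) (min (2 * track r w) (r (b :: w)))

section Track

variable {r : List Bool → ℝ} (hr : ∀ w, r w ∈ Ioo (0 : ℝ) 1)

include hr

theorem track_mem (w : List Bool) : track r w ∈ Ioo (0 : ℝ) 1 := by
  induction w with
  | nil => exact hr []
  | cons b w ih =>
    obtain ⟨h0, h1⟩ := ih
    obtain ⟨h0', h1'⟩ := hr (b :: w)
    exact ⟨lt_max_of_lt_right (lt_min (by linarith) h0'),
      max_lt (by linarith) ((min_le_right _ _).trans_lt h1')⟩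

omit hr in
theorem isDyadic_track (hd : ∀ w, IsDyadic (r w)) (w : List Bool) : IsDyadic (track r w) := by
  induction w with
  | nil => exact hd []
  | cons b w ih =>
    have h1 : IsDyadic (2 * track r w - 1) := ih.two_mul_sub (by simpa using isDyadic_intCast 1)
    have h2 : IsDyadic (2 * track r w) := by
      simpa using ih.two_mul_sub (q' := 0) (by simpa using isDyadic_intCast 0)
    rw [track]
    rcases max_choice (2 * track r w - 1) (min (2 * track r w) (r (b :: w))) with h | h <;> rw [h]
    · exact h1
    · rcases min_choice (2 * track r w) (r (b :: w)) with h | h <;> rw [h]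
      · exact h2
      · exact hd _

theorem two_mul_track_sub_mem (b : Bool) (w : List Bool) :
    2 * track r w - track r (b :: w) ∈ Icc (0 : ℝ) 1 := by
  obtain ⟨h0, h1⟩ := track_mem hr w
  rw [track]
  constructor
  · have : max (2 * track r w - 1) (min (2 * track r w) (r (b :: w))) ≤ 2 * track r w :=
      max_le (by linarith) (min_le_left _ _)
    linarith
  · linarith [le_max_left (2 * track r w - 1) (min (2 * track r w) (r (b :: w)))]

/-- A bound `c < 1` on the target is eventually a bound on `track`, because `1 - track` doubles
as long as it is smaller than `1 - c`. -/
theorem eventually_track_le {z : Cantor} {c : ℝ} (hc : c < 1)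
    (h : ∀ᶠ n in atTop, r (PiNat.res z n) ≤ c) : ∀ᶠ n in atTop, track r (PiNat.res z n) ≤ c := by
  obtain ⟨N, hN⟩ := eventually_atTop.1 h
  set t : ℕ → ℝ := fun n => track r (PiNat.res z n) with ht
  have hstep : ∀ n, N ≤ n → min (1 - c) (2 * (1 - t n)) ≤ 1 - t (n + 1) := by
    intro n hn
    have h1 : t (n + 1) ≤ max (2 * t n - 1) c :=
      max_le_max_left _ ((min_le_right _ _).trans (hN (n + 1) (by omega)))
    rcases le_total (2 * t n - 1) c with h2 | h2
    · rw [max_eq_right h2] at h1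
      exact (min_le_left _ _).trans (by linarith)
    · rw [max_eq_left h2] at h1
      exact (min_le_right _ _).trans (by linarith)
  have hpow : ∀ k, min (1 - c) (2 ^ k * (1 - t N)) ≤ 1 - t (N + k) := by
    intro k
    induction k with
    | zero => simp
    | succ k ih =>
      refine le_trans ?_ (hstep (N + k) (by omega))
      have h1c : 0 < 1 - c := by linarith
      refine le_min (min_le_left _ _) ?_
      rw [pow_succ]
      rcases le_total (1 - c) (2 ^ k * (1 - t N)) with h | h
      · rw [min_eq_left h] at ih
        exact (min_le_left _ _).trans (by linarith)
      · rw [min_eq_right h] at ih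
        exact (min_le_right _ _).trans (by linarith)
  have htN : 0 < 1 - t N := sub_pos.2 (track_mem hr _).2
  obtain ⟨k, hk⟩ := pow_unbounded_of_one_lt ((1 - c) / (1 - t N)) one_lt_two
  rw [div_lt_iff₀ htN] at hk
  refine eventually_atTop.2 ⟨N + k, fun n hn => ?_⟩
  obtain ⟨j, rfl⟩ := Nat.exists_eq_add_of_le hn
  have h1 := hpow (k + j)
  have h2 : (2 : ℝ) ^ k * (1 - t N) ≤ 2 ^ (k + j) * (1 - t N) := by
    gcongr
    · norm_num
    · omega
  rw [min_eq_left (by linarith), ← add_assoc] at h1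
  linarith

/-- A bound `c > 0` from below on the target is eventually a bound on `track`, because `track`
doubles as long as it is smaller than `c`. -/
theorem eventually_le_track {z : Cantor} {c : ℝ} (hc : 0 < c)
    (h : ∀ᶠ n in atTop, c ≤ r (PiNat.res z n)) : ∀ᶠ n in atTop, c ≤ track r (PiNat.res z n) := by
  -- the mirror image of `eventually_track_le` under `t ↦ 1 - t`
  have hmirror : ∀ w, track (fun w => 1 - r w) w = 1 - track r w := by
    intro w
    induction w with
    | nil => rfl
    | cons b w ih =>
      obtain ⟨h0, h1⟩ := track_mem hr w
      rw [track, track, ih]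
      simp only [max_def, min_def]
      split_ifs <;> linarith
  have := eventually_track_le (r := fun w => 1 - r w) (z := z) (c := 1 - c)
    (fun w => ⟨by linarith [(hr w).2], by linarith [(hr w).1]⟩) (by linarith)
    (h.mono fun n hn => by linarith)
  exact this.mono fun n hn => by rw [hmirror] at hn; linarith

theorem tendsto_track {z : Cantor} {g : ℝ}
    (h : Tendsto (fun n => r (PiNat.res z n)) atTop (𝓝 g)) :
    Tendsto (fun n => track r (PiNat.res z n)) atTop (𝓝 g) := by
  refine tendsto_order.2 ⟨fun a ha => ?_, fun a ha => ?_⟩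
  · obtain ⟨c, hac, hcg⟩ := exists_between ha
    rcases le_or_gt c 0 with hc | hc
    · exact Eventually.of_forall fun n => by linarith [(track_mem hr (PiNat.res z n)).1]
    · exact (eventually_le_track hr hc ((h.eventually_const_lt hcg).mono fun _ => le_of_lt)).mono
        fun n hn => hac.trans_le hn
  · obtain ⟨c, hgc, hca⟩ := exists_between ha
    rcases le_or_gt 1 c with hc | hc
    · exact Eventually.of_forall fun n => by linarith [(track_mem hr (PiNat.res z n)).2]
    · exact (eventually_track_le hr hc ((h.eventually_lt_const hgc).mono fun _ => le_of_lt)).mono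
        fun n hn => hn.trans_lt hca

end Track

/-- The stages of the construction at the nodes of the binary tree: reading the next bit of a word
`w`, adjusting the density after the bit `b` has been read, or filling a clopen set of relative
measure `q`. -/
inductive Stage
  | read (w : List Bool)
  | steer (b : Bool) (w : List Bool)
  | fill (q : ℝ)

/-- The intended relative measure of the compact set at a node. -/
noncomputable def Stage.dens (r : List Bool → ℝ) : Stage → ℝ
  | read w => track r w
  | steer _ w => track r w
  | fill q => q

/-- The stages of the two children of a node. -/
noncomputable def Stage.step (r : List Bool → ℝ) : Stage → Bool → Stage
  | read w, b => steer b w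
  | steer b w, false => read (b :: w)
  | steer b w, true => fill (2 * track r w - track r (b :: w))
  | fill q, false => fill (min (2 * q) 1)
  | fill q, true => fill (max (2 * q - 1) 0)

/-- The stage at the node `u` of the binary tree. -/
noncomputable def stage (r : List Bool → ℝ) : List Bool → Stage
  | [] => .read []
  | b :: u => (stage r u).step r b

/-- The compact set whose relative measures are the intended ones. -/
def realSet (r : List Bool → ℝ) : Set Cantor :=
  {z | ∀ n, (stage r (PiNat.res z n)).dens r ≠ 0}

/-- The intended relative measures form a martingale. -/
theorem dens_eq (r : List Bool → ℝ) (s : Stage) :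
    s.dens r = ((s.step r false).dens r + (s.step r true).dens r) / 2 := by
  cases s with
  | read w => simp [Stage.dens, Stage.step]
  | steer b w => simp [Stage.dens, Stage.step]
  | fill q =>
    simp only [Stage.dens, Stage.step]
    rcases le_total (2 * q) 1 with h | h
    · rw [min_eq_left h, max_eq_right (by linarith)]
      ring
    · rw [min_eq_right h, max_eq_left (by linarith)]
      ring

theorem isClosed_realSet (r : List Bool → ℝ) : IsClosed (realSet r) := by
  have : realSet r = ⋂ u ∈ {u | (stage r u).dens r = 0}, (cyl u)ᶜ := by
    ext z
    simp only [realSet, mem_ofPred_eq, mem_iInter, mem_compl_iff]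
    constructor
    · intro h u hu hz
      rw [cyl, mem_ofPred_eq] at hz
      exact h u.length (by rw [hz]; exact hu)
    · intro h n hn
      exact h _ hn (self_mem_cyl_res z n)
  rw [this]
  exact isClosed_biInter fun u _ => (isClopen_cyl u).2.isClosed_compl

/-- The branch of the binary tree along which the construction reads the bits of `z`. -/
def realBranch (z : Cantor) : Cantor :=
  fun n => if n % 2 = 0 then z (n / 2) else false

section Real

variable {r : List Bool → ℝ} (hr : ∀ w, r w ∈ Ioo (0 : ℝ) 1) (hd : ∀ w, IsDyadic (r w))

include hr hd

theorem stage_fill (u : List Bool) {q : ℝ} (h : stage r u = .fill q) :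
    q ∈ Icc (0 : ℝ) 1 ∧ IsDyadic q := by
  induction u generalizing q with
  | nil => simp [stage] at h
  | cons b u ih =>
    rw [stage] at h
    cases hs : stage r u with
    | read w => simp [hs, Stage.step] at h
    | steer c w =>
      cases b with
      | false => simp [hs, Stage.step] at h
      | true =>
        simp only [hs, Stage.step, Stage.fill.injEq] at h
        rw [← h]
        exact ⟨two_mul_track_sub_mem hr c w,
          (isDyadic_track hd w).two_mul_sub (isDyadic_track hd _)⟩
    | fill q' =>
      obtain ⟨⟨h0, h1⟩, hq⟩ := ih hs
      cases b with
      | false =>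
        simp only [hs, Stage.step, Stage.fill.injEq] at h
        rw [← h]
        refine ⟨⟨le_min (by linarith) zero_le_one, min_le_right _ _⟩, ?_⟩
        rcases min_choice (2 * q') 1 with h | h <;> rw [h]
        · simpa using hq.two_mul_sub (q' := 0) (by simpa using isDyadic_intCast 0)
        · simpa using isDyadic_intCast 1
      | true =>
        simp only [hs, Stage.step, Stage.fill.injEq] at h
        rw [← h]
        refine ⟨⟨le_max_right _ _, max_le (by linarith) zero_le_one⟩, ?_⟩
        rcases max_choice (2 * q' - 1) 0 with h | h <;> rw [h]
        · simpa using hq.two_mul_sub (q' := 1) (by simpa using isDyadic_intCast 1)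
        · simpa using isDyadic_intCast 0

omit hd in
theorem stage_eq_fill_zero {u : List Bool} (h : (stage r u).dens r = 0) : stage r u = .fill 0 := by
  cases hs : stage r u with
  | read w => simp [hs, Stage.dens, (track_mem hr w).1.ne'] at h
  | steer b w => simp [hs, Stage.dens, (track_mem hr w).1.ne'] at h
  | fill q => rw [hs, Stage.dens] at h; rw [h]

omit hr hd in
theorem stage_fill_const {z : Cantor} {n : ℕ} {q : ℝ} (hq : q = 0 ∨ q = 1)
    (h : stage r (PiNat.res z n) = .fill q) (m : ℕ) (hm : n ≤ m) :
    stage r (PiNat.res z m) = .fill q := by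
  induction m, hm using Nat.le_induction with
  | base => exact h
  | succ m _ ih =>
    rw [PiNat.res_succ, stage, ih]
    rcases hq with rfl | rfl <;> cases z m <;> norm_num [Stage.step]

/-- A cylinder in which a clopen set of dyadic relative measure is filled in does receive this
relative measure. -/
theorem relMeasure_of_stage_fill (d : ℕ) : ∀ (u : List Bool) (q : ℝ), stage r u = .fill q →
    (∃ p : ℤ, q * 2 ^ d = p) → relMeasure (realSet r) u = q := by
  induction d with
  | zero =>
    rintro u q h ⟨p, hp⟩
    rw [pow_zero, mul_one] at hp
    have hq := eq_zero_or_eq_one_of_intCast (stage_fill hr hd u h).1 hp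
    have hres : ∀ z ∈ cyl u, stage r (PiNat.res z u.length) = .fill q := by
      intro z hz
      rw [cyl, mem_ofPred_eq] at hz
      rw [hz, h]
    rcases hq with rfl | rfl
    · refine relMeasure_of_disjoint (Set.disjoint_left.2 fun z hz hzu => hz u.length ?_)
      rw [hres z hzu]
      rfl
    · refine relMeasure_of_cyl_subset fun z hz n hn => ?_
      have h2 := stage_fill_const (Or.inr rfl) (hres z hz) (max n u.length) (le_max_right _ _)
      rw [stage_fill_const (Or.inl rfl) (stage_eq_fill_zero hr hn) (max n u.length)
        (le_max_left _ _)] at h2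
      norm_num at h2
  | succ d ih =>
    rintro u q h ⟨p, hp⟩
    have h2 : 2 * q * 2 ^ d = p := by rw [← hp]; ring
    rw [relMeasure_eq, ih (false :: u) (min (2 * q) 1) (by rw [stage, h]; rfl),
      ih (true :: u) (max (2 * q - 1) 0) (by rw [stage, h]; rfl)]
    · simpa [Stage.dens, Stage.step] using (dens_eq r (.fill q)).symm
    · rcases max_choice (2 * q - 1) 0 with h | h <;> rw [h]
      · exact ⟨p - 2 ^ d, by push_cast; rw [sub_mul, h2, one_mul]⟩
      · exact ⟨0, by simp⟩
    · rcases min_choice (2 * q) 1 with h | h <;> rw [h]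
      · exact ⟨p, h2⟩
      · exact ⟨2 ^ d, by simp⟩

/-- The error of the relative measure is the mean of the errors at the two children, and it vanishes
where a clopen set is filled in. Hence it halves with every round of reading and steering. -/
theorem abs_relMeasure_sub_dens_le (k : ℕ) : ∀ u w, stage r u = .read w →
    |relMeasure (realSet r) u - track r w| ≤ (1 / 2) ^ k := by
  induction k with
  | zero =>
    intro u w _
    have := track_mem hr w
    rw [pow_zero, abs_le]
    constructor <;>
      linarith [relMeasure_nonneg (realSet r) u, relMeasure_le_one (realSet r) u, this.1, this.2]
  | succ k ih =>
    intro u w h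
    have key : ∀ b, |relMeasure (realSet r) (b :: u) - track r w| ≤ (1 / 2) ^ (k + 1) := by
      intro b
      have hb : stage r (b :: u) = .steer b w := by rw [stage, h]; rfl
      have h0 := ih (false :: b :: u) (b :: w) (by rw [stage, hb]; rfl)
      have hf : stage r (true :: b :: u) = .fill (2 * track r w - track r (b :: w)) := by
        rw [stage, hb]; rfl
      obtain ⟨d, hp⟩ := (stage_fill hr hd _ hf).2
      have h1 := relMeasure_of_stage_fill hr hd d _ _ hf hp
      rw [relMeasure_eq, h1, pow_succ]
      rw [abs_le] at h0 ⊢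
      constructor <;> linarith
    have h0 := key false
    have h1 := key true
    rw [relMeasure_eq]
    rw [abs_le] at h0 h1 ⊢
    constructor <;> linarith

theorem relMeasure_realSet (u : List Bool) :
    relMeasure (realSet r) u = (stage r u).dens r := by
  have hread : ∀ u w, stage r u = .read w → relMeasure (realSet r) u = track r w := by
    intro u w h
    have : Tendsto (fun k : ℕ => (1 / 2 : ℝ) ^ k) atTop (𝓝 0) :=
      tendsto_pow_atTop_nhds_zero_of_lt_one (by norm_num) (by norm_num)
    have h0 := ge_of_tendsto' this fun k => abs_relMeasure_sub_dens_le hr hd k u w h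
    exact sub_eq_zero.1 (abs_nonpos_iff.1 h0)
  have hfill : ∀ u q, stage r u = .fill q → relMeasure (realSet r) u = q := by
    intro u q h
    obtain ⟨d, hp⟩ := (stage_fill hr hd _ h).2
    exact relMeasure_of_stage_fill hr hd d u q h hp
  cases h : stage r u with
  | read w => exact hread u w h
  | fill q => exact hfill u q h
  | steer b w =>
    rw [relMeasure_eq, hread (false :: u) (b :: w) (by rw [stage, h]; rfl),
      hfill (true :: u) _ (by rw [stage, h]; rfl)]
    simp [Stage.dens]

/-- The clopen sets that are filled in have only the densities `0` and `1`, because their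
relative measures become integers after finitely many halvings of the denominator. -/
theorem hasDensity_of_stage_fill {z : Cantor} {n : ℕ} {q : ℝ}
    (h : stage r (PiNat.res z n) = .fill q) :
    HasDensity (realSet r) z 0 ∨ HasDensity (realSet r) z 1 := by
  have hmain : ∀ (d n : ℕ) (q : ℝ), stage r (PiNat.res z n) = .fill q →
      (∃ p : ℤ, q * 2 ^ d = p) →
      ∃ m q, (q = 0 ∨ q = 1) ∧ stage r (PiNat.res z m) = .fill q := by
    intro d
    induction d with
    | zero =>
      rintro n q h ⟨p, hp⟩
      rw [pow_zero, mul_one] at hp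
      exact ⟨n, q, eq_zero_or_eq_one_of_intCast (stage_fill hr hd _ h).1 hp, h⟩
    | succ d ih =>
      rintro n q h ⟨p, hp⟩
      have h2 : 2 * q * 2 ^ d = p := by rw [← hp]; ring
      cases hz : z n with
      | false =>
        refine ih (n + 1) (min (2 * q) 1) (by rw [PiNat.res_succ, stage, h, hz]; rfl) ?_
        rcases min_choice (2 * q) 1 with h | h <;> rw [h]
        · exact ⟨p, h2⟩
        · exact ⟨2 ^ d, by simp⟩
      | true =>
        refine ih (n + 1) (max (2 * q - 1) 0) (by rw [PiNat.res_succ, stage, h, hz]; rfl) ?_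
        rcases max_choice (2 * q - 1) 0 with h | h <;> rw [h]
        · exact ⟨p - 2 ^ d, by push_cast; rw [sub_mul, h2, one_mul]⟩
        · exact ⟨0, by simp⟩
  obtain ⟨d, hp⟩ := (stage_fill hr hd _ h).2
  obtain ⟨m, q, hq, hm⟩ := hmain d n q h hp
  have : HasDensity (realSet r) z q := by
    rw [hasDensity_iff]
    refine tendsto_const_nhds.congr' (eventually_atTop.2 ⟨m, fun k hk => ?_⟩)
    show q = relMeasure (realSet r) (PiNat.res z k)
    rw [relMeasure_realSet hr hd, stage_fill_const hq hm k hk]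
    rfl
  rcases hq with rfl | rfl
  · exact Or.inl this
  · exact Or.inr this

omit hr hd in
theorem stage_realBranch (z : Cantor) (n : ℕ) :
    stage r (PiNat.res (realBranch z) (2 * n)) = .read (PiNat.res z n) ∧
      stage r (PiNat.res (realBranch z) (2 * n + 1)) = .steer (z n) (PiNat.res z n) := by
  have hodd : ∀ n, stage r (PiNat.res (realBranch z) (2 * n)) = .read (PiNat.res z n) →
      stage r (PiNat.res (realBranch z) (2 * n + 1)) = .steer (z n) (PiNat.res z n) := by
    intro n h
    rw [PiNat.res_succ, stage, h, Stage.step]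
    simp [realBranch]
  induction n with
  | zero => exact ⟨rfl, hodd 0 rfl⟩
  | succ n ih =>
    have : stage r (PiNat.res (realBranch z) (2 * (n + 1))) = .read (PiNat.res z (n + 1)) := by
      rw [show 2 * (n + 1) = 2 * n + 1 + 1 by ring, PiNat.res_succ, stage, ih.2]
      have : realBranch z (2 * n + 1) = false := by
        simp [realBranch, Nat.add_mod]
      rw [this]
      rfl
    exact ⟨this, hodd _ this⟩

theorem hasDensity_realBranch {z : Cantor} {g : ℝ}
    (h : Tendsto (fun n => r (PiNat.res z n)) atTop (𝓝 g)) :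
    HasDensity (realSet r) (realBranch z) g := by
  have ht := tendsto_track hr h
  rw [hasDensity_iff]
  have : ∀ n, relMeasure (realSet r) (PiNat.res (realBranch z) n) = track r (PiNat.res z (n / 2)) := by
    intro n
    rw [relMeasure_realSet hr hd]
    rcases Nat.even_or_odd' n with ⟨k, rfl | rfl⟩
    · rw [(stage_realBranch z k).1]
      simp [Stage.dens]
    · rw [(stage_realBranch z k).2, show (2 * k + 1) / 2 = k by omega]
      rfl
  simp only [this]
  exact ht.comp (Nat.tendsto_div_const_atTop two_ne_zero)

omit hr hd in
/-- The branches on which no clopen set is ever filled in are those that read some `z`. -/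
theorem eq_realBranch_of_stage {z : Cantor} (h : ∀ n q, stage r (PiNat.res z n) ≠ .fill q) :
    z = realBranch fun n => z (2 * n) := by
  have hread : ∀ n, ∃ w, stage r (PiNat.res z (2 * n)) = .read w := by
    intro n
    induction n with
    | zero => exact ⟨[], rfl⟩
    | succ n ih =>
      obtain ⟨w, hw⟩ := ih
      have h1 : stage r (PiNat.res z (2 * n + 1)) = .steer (z (2 * n)) w := by
        rw [PiNat.res_succ, stage, hw]; rfl
      have h2 := h (2 * n + 1 + 1)
      rw [show 2 * (n + 1) = 2 * n + 1 + 1 by ring, PiNat.res_succ, stage, h1]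
      rw [PiNat.res_succ, stage, h1] at h2
      cases hz : z (2 * n + 1) with
      | false => exact ⟨_, rfl⟩
      | true => rw [hz] at h2; exact absurd rfl (h2 _)
  funext n
  rcases Nat.even_or_odd' n with ⟨k, rfl | rfl⟩
  · simp [realBranch]
  · obtain ⟨w, hw⟩ := hread k
    have h1 : stage r (PiNat.res z (2 * k + 1)) = .steer (z (2 * k)) w := by
      rw [PiNat.res_succ, stage, hw]; rfl
    have h2 := h (2 * k + 1 + 1)
    rw [PiNat.res_succ, stage, h1] at h2
    have : realBranch (fun n => z (2 * n)) (2 * k + 1) = false := by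
      simp [realBranch, Nat.add_mod]
    rw [this]
    cases hz : z (2 * k + 1) with
    | false => rfl
    | true => rw [hz] at h2; exact absurd rfl (h2 _)

end Real

theorem HasDensity.unique {A : Set Cantor} {z : Cantor} {r s : ℝ} (h : HasDensity A z r)
    (h' : HasDensity A z s) : r = s :=
  tendsto_nhds_unique h h'

/-- If `r` converges to `g` along the branches of the binary tree, then there is a solid compact set
whose densities inside `(0, 1)` are those values of `g`, attained as often as by `g`. -/
theorem exists_solid_of_tendsto {r : List Bool → ℝ} {g : Cantor → ℝ} (hr : ∀ w, r w ∈ Ico (0 : ℝ) 1)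
    (hg : ∀ z, Tendsto (fun n => r (PiNat.res z n)) atTop (𝓝 (g z))) :
    ∃ K : Hyperspace, K ∈ Sld ∧
      (∀ x ∈ Ioo (0 : ℝ) 1, (∃ z, HasDensity K z x) ↔ ∃ z, g z = x) ∧
      (InjOn g (g ⁻¹' Ioo 0 1) → K ∈ RngInj) := by
  -- dyadic approximations of `r` inside the open unit interval
  set r' : List Bool → ℝ := fun w => (2 * (⌊r w * 2 ^ w.length⌋ : ℝ) + 1) / 2 ^ (w.length + 1)
    with hr'
  have hfl : ∀ w, (0 : ℝ) ≤ ⌊r w * 2 ^ w.length⌋ := by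
    intro w
    have : 0 ≤ ⌊r w * 2 ^ w.length⌋ := Int.floor_nonneg.2 (mul_nonneg (hr w).1 (by positivity))
    exact_mod_cast this
  have hfl' : ∀ w : List Bool, (⌊r w * 2 ^ w.length⌋ : ℝ) + 1 ≤ 2 ^ w.length := by
    intro w
    have : ⌊r w * 2 ^ w.length⌋ < 2 ^ w.length := by
      rw [Int.floor_lt]
      push_cast
      exact mul_lt_of_lt_one_left (by positivity) (hr w).2
    have := Int.add_one_le_iff.2 this
    exact_mod_cast this
  have hr01 : ∀ w, r' w ∈ Ioo (0 : ℝ) 1 := by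
    intro w
    have h1 := hfl w
    have h2 := hfl' w
    refine ⟨by positivity, ?_⟩
    rw [hr', div_lt_one (by positivity), pow_succ]
    linarith
  have hdy : ∀ w, IsDyadic (r' w) := fun w =>
    ⟨w.length + 1, 2 * ⌊r w * 2 ^ w.length⌋ + 1, by
      rw [hr']
      push_cast
      field_simp⟩
  have hclose : ∀ w, |r' w - r w| ≤ (1 / 2) ^ w.length := by
    intro w
    have h1 := Int.floor_le (r w * 2 ^ w.length)
    have h2 := Int.lt_floor_add_one (r w * 2 ^ w.length)
    have hp : (0 : ℝ) < 2 ^ w.length := by positivity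
    have : (r' w - r w) * 2 ^ w.length = ⌊r w * 2 ^ w.length⌋ + 1 / 2 - r w * 2 ^ w.length := by
      simp only [hr', pow_succ]
      field_simp
    rw [one_div, inv_pow, ← one_div, le_div_iff₀ hp]
    rw [← abs_of_pos hp, ← abs_mul, this, abs_le]
    constructor <;> linarith
  have hg' : ∀ z, Tendsto (fun n => r' (PiNat.res z n)) atTop (𝓝 (g z)) := by
    intro z
    have h0 : Tendsto (fun n => r' (PiNat.res z n) - r (PiNat.res z n)) atTop (𝓝 0) := by
      refine squeeze_zero_norm (fun n => ?_)
        (tendsto_pow_atTop_nhds_zero_of_lt_one (r := (1 / 2 : ℝ)) (by norm_num) (by norm_num))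
      have := hclose (PiNat.res z n)
      rwa [PiNat.res_length] at this
    simpa using h0.add (hg z)
  have hall : ∀ z, (HasDensity (realSet r') z 0 ∨ HasDensity (realSet r') z 1) ∨
      ∃ z', z = realBranch z' := by
    intro z
    by_cases h : ∃ n q, stage r' (PiNat.res z n) = .fill q
    · obtain ⟨n, q, h⟩ := h
      exact Or.inl (hasDensity_of_stage_fill hr01 hdy h)
    · push Not at h
      exact Or.inr ⟨_, eq_realBranch_of_stage h⟩
  have hbr : ∀ z, HasDensity (realSet r') (realBranch z) (g z) := fun z =>
    hasDensity_realBranch hr01 hdy (hg' z)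
  have hin : ∀ z, ∀ x ∈ Ioo (0 : ℝ) 1, HasDensity (realSet r') z x →
      ∃ z', z = realBranch z' ∧ g z' = x := by
    rintro z x hx h
    rcases hall z with (h0 | h1) | ⟨z', rfl⟩
    · exact absurd (h.unique h0) hx.1.ne'
    · exact absurd (h.unique h1) hx.2.ne
    · exact ⟨z', rfl, (hbr z').unique h⟩
  refine ⟨⟨realSet r', (isClosed_realSet r').isCompact⟩, ?_, ?_, ?_⟩
  · intro z hz
    rcases hall z with (h0 | h1) | ⟨z', rfl⟩
    · exact hz ⟨_, h0⟩
    · exact hz ⟨_, h1⟩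
    · exact hz ⟨_, hbr z'⟩
  · intro x hx
    constructor
    · rintro ⟨z, hz⟩
      obtain ⟨z', -, h⟩ := hin z x hx hz
      exact ⟨z', h⟩
    · rintro ⟨z, rfl⟩
      exact ⟨_, hbr z⟩
  · intro hinj z₁ z₂ x hx h₁ h₂
    obtain ⟨z₁', rfl, hg₁⟩ := hin z₁ x hx h₁
    obtain ⟨z₂', rfl, hg₂⟩ := hin z₂ x hx h₂
    have : z₁' = z₂' := hinj (by rw [mem_preimage, hg₁]; exact hx)
      (by rw [mem_preimage, hg₂]; exact hx) (hg₁.trans hg₂.symm)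
    rw [this]

/-! ### Closed subsets of the Baire space as sets of branches of the binary tree -/

section Walk

open Classical in
/-- The child with number `m` of the node `(d, l)`, which stands for the points of `E` that agree
with `d ∈ E` below `l`. For `m = Nat.pair i j` and `k = l + i`, the child consists of those points
that agree with `d` below `k` and take the value `j ≠ d k` at `k`. It is `none` if there are no such
points. -/
noncomputable def child (E : Set Baire) (p : Baire × ℕ) (m : ℕ) : Option (Baire × ℕ) :=
  if h : ∃ y ∈ E, y ∈ PiNat.cylinder p.1 (p.2 + m.unpair.1) ∧ y (p.2 + m.unpair.1) = m.unpair.2 ∧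
      m.unpair.2 ≠ p.1 (p.2 + m.unpair.1)
  then some (h.choose, p.2 + m.unpair.1 + 1) else none

/-- The node reached along a binary word, and the number of entries `false` since it was reached:
an entry `true` after `m` entries `false` leads to the child with number `m`. -/
noncomputable def walk (E : Set Baire) (d₀ : Baire) : List Bool → Option (Baire × ℕ) × ℕ
  | [] => (some (d₀, 0), 0)
  | false :: w => ((walk E d₀ w).1, (walk E d₀ w).2 + 1)
  | true :: w => ((walk E d₀ w).1.bind fun p => child E p (walk E d₀ w).2, 0)

/-- The nodes along the branch `z` shrink to the point `x`. -/
def Tracks (E : Set Baire) (d₀ : Baire) (z : Cantor) (x : Baire) : Prop :=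
  ∃ (d : ℕ → Baire) (l : ℕ → ℕ), (∀ n, (walk E d₀ (PiNat.res z n)).1 = some (d n, l n)) ∧
    (∀ n, x ∈ PiNat.cylinder (d n) (l n)) ∧ Tendsto d atTop (𝓝 x)

variable {E : Set Baire} {d₀ : Baire}

theorem child_eq_some {p p' : Baire × ℕ} {m : ℕ} (h : child E p m = some p') :
    p'.1 ∈ E ∧ p'.2 = p.2 + m.unpair.1 + 1 ∧ p'.1 ∈ PiNat.cylinder p.1 (p.2 + m.unpair.1) ∧
      p'.1 (p.2 + m.unpair.1) = m.unpair.2 ∧ m.unpair.2 ≠ p.1 (p.2 + m.unpair.1) := by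
  unfold child at h
  split_ifs at h with hy
  obtain ⟨h1, h2, h3, h4⟩ := hy.choose_spec
  obtain rfl := Option.some.inj h
  exact ⟨h1, rfl, h2, h3, h4⟩

/-- A point of a child branches off from the parent exactly where the number of the child says. -/
theorem child_spec {p p' : Baire × ℕ} {m : ℕ} (h : child E p m = some p') {x : Baire}
    (hx : x ∈ PiNat.cylinder p'.1 p'.2) :
    x ∈ PiNat.cylinder p.1 (p.2 + m.unpair.1) ∧ x (p.2 + m.unpair.1) = m.unpair.2 ∧
      x (p.2 + m.unpair.1) ≠ p.1 (p.2 + m.unpair.1) := by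
  obtain ⟨-, h2, h3, h4, h5⟩ := child_eq_some h
  rw [h2] at hx
  have hk : x (p.2 + m.unpair.1) = m.unpair.2 := (hx _ (Nat.lt_succ_self _)).trans h4
  refine ⟨fun i hi => ?_, hk, hk ▸ h5⟩
  rw [hx i (by omega), h3 i hi]

theorem child_unique {p p₁ p₂ : Baire × ℕ} {m₁ m₂ : ℕ} (h₁ : child E p m₁ = some p₁)
    (h₂ : child E p m₂ = some p₂) {x : Baire} (hx₁ : x ∈ PiNat.cylinder p₁.1 p₁.2)
    (hx₂ : x ∈ PiNat.cylinder p₂.1 p₂.2) : m₁ = m₂ := by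
  obtain ⟨a₁, b₁, c₁⟩ := child_spec h₁ hx₁
  obtain ⟨a₂, b₂, c₂⟩ := child_spec h₂ hx₂
  have hi : m₁.unpair.1 = m₂.unpair.1 := by
    rcases lt_trichotomy m₁.unpair.1 m₂.unpair.1 with h | h | h
    · exact absurd (a₂ _ (by omega)) c₁
    · exact h
    · exact absurd (a₁ _ (by omega)) c₂
  have hj : m₁.unpair.2 = m₂.unpair.2 := by
    rw [← b₁, ← b₂, hi]
  rw [← Nat.pair_unpair m₁, ← Nat.pair_unpair m₂, hi, hj]

theorem exists_child {p : Baire × ℕ} {x : Baire} (hxE : x ∈ E) (hx : x ∈ PiNat.cylinder p.1 p.2)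
    (hne : x ≠ p.1) : ∃ m p', child E p m = some p' ∧ x ∈ PiNat.cylinder p'.1 p'.2 := by
  have hl : p.2 ≤ PiNat.firstDiff x p.1 :=
    (PiNat.mem_cylinder_iff_le_firstDiff hne _).1 hx
  obtain ⟨i, hi⟩ := Nat.exists_eq_add_of_le hl
  have hex : ∃ y ∈ E, y ∈ PiNat.cylinder p.1 (p.2 + (Nat.pair i (x (p.2 + i))).unpair.1) ∧
      y (p.2 + (Nat.pair i (x (p.2 + i))).unpair.1) = (Nat.pair i (x (p.2 + i))).unpair.2 ∧
      (Nat.pair i (x (p.2 + i))).unpair.2 ≠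
        p.1 (p.2 + (Nat.pair i (x (p.2 + i))).unpair.1) := by
    refine ⟨x, hxE, ?_, ?_, ?_⟩ <;> rw [Nat.unpair_pair, ← hi]
    · exact PiNat.mem_cylinder_firstDiff x p.1
    · exact PiNat.apply_firstDiff_ne hne
  obtain ⟨p', hc⟩ : ∃ p', child E p (Nat.pair i (x (p.2 + i))) = some p' := ⟨_, dif_pos hex⟩
  refine ⟨_, _, hc, ?_⟩
  obtain ⟨-, h2, h3, h4, h5⟩ := child_eq_some hc
  rw [Nat.unpair_pair] at h2 h3 h4
  rw [h2]
  intro j hj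
  rcases Nat.lt_succ_iff_lt_or_eq.1 hj with hj | rfl
  · exact (PiNat.mem_cylinder_firstDiff x p.1 j (by simpa [hi] using hj)).trans (h3 j hj).symm
  · exact h4.symm

theorem walk_mem (hd₀ : d₀ ∈ E) (w : List Bool) {p : Baire × ℕ} (h : (walk E d₀ w).1 = some p) :
    p.1 ∈ E := by
  induction w generalizing p with
  | nil =>
    obtain rfl := Option.some.inj h
    exact hd₀
  | cons b w ih =>
    cases b with
    | false => exact ih h
    | true =>
      obtain ⟨q, hq, hc⟩ := Option.bind_eq_some_iff.1 h
      exact (child_eq_some hc).1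

theorem walk_succ {z : Cantor} {n : ℕ} {p : Baire × ℕ}
    (h : (walk E d₀ (PiNat.res z (n + 1))).1 = some p) :
    ∃ q, (walk E d₀ (PiNat.res z n)).1 = some q ∧ (z n = false ∧ p = q ∨
      z n = true ∧ child E q (walk E d₀ (PiNat.res z n)).2 = some p) := by
  rw [PiNat.res_succ] at h
  cases hz : z n with
  | false =>
    rw [hz] at h
    exact ⟨p, h, Or.inl ⟨rfl, rfl⟩⟩
  | true =>
    rw [hz] at h
    obtain ⟨q, hq, hc⟩ := Option.bind_eq_some_iff.1 h
    exact ⟨q, hq, Or.inr ⟨rfl, hc⟩⟩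

theorem walk_none {z : Cantor} {n m : ℕ} (h : (walk E d₀ (PiNat.res z n)).1 = none) (hm : n ≤ m) :
    (walk E d₀ (PiNat.res z m)).1 = none := by
  induction m, hm using Nat.le_induction with
  | base => exact h
  | succ m _ ih =>
    by_contra hne
    obtain ⟨p, hp⟩ := Option.ne_none_iff_exists'.1 hne
    obtain ⟨q, hq, -⟩ := walk_succ hp
    rw [ih] at hq
    cases hq

/-- Along a branch, the nodes shrink. -/
theorem walk_mono {z : Cantor} {d : ℕ → Baire} {l : ℕ → ℕ}
    (h : ∀ n, (walk E d₀ (PiNat.res z n)).1 = some (d n, l n)) {n m : ℕ} (hm : n ≤ m) :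
    l n ≤ l m ∧ d m ∈ PiNat.cylinder (d n) (l n) ∧ (l m = l n → d m = d n) := by
  induction m, hm using Nat.le_induction with
  | base => exact ⟨le_rfl, PiNat.self_mem_cylinder _ _, fun _ => rfl⟩
  | succ m _ ih =>
    obtain ⟨h1, h2, h3⟩ := ih
    obtain ⟨q, hq, ⟨-, hp⟩ | ⟨-, hc⟩⟩ := walk_succ (h (m + 1))
    · rw [h m] at hq
      obtain rfl := Option.some.inj hq
      obtain ⟨hd, hl⟩ := Prod.mk.inj hp
      rw [hd, hl]
      exact ⟨h1, h2, h3⟩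
    · rw [h m] at hq
      obtain rfl := Option.some.inj hq
      obtain ⟨-, e2, e3, -⟩ := child_eq_some hc
      simp only at e2 e3
      refine ⟨by omega, fun i hi => ?_, fun he => by omega⟩
      rw [e3 i (by omega), h2 i hi]

/-- The nodes along a branch that never reaches an empty node shrink to a point of `E`: either their
lengths tend to infinity, or the node is eventually the same. -/
theorem exists_tracks_of_walk (hE : IsClosed E) (hd₀ : d₀ ∈ E) {z : Cantor} {d : ℕ → Baire}
    {l : ℕ → ℕ} (h : ∀ n, (walk E d₀ (PiNat.res z n)).1 = some (d n, l n)) :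
    ∃ x ∈ E, (∀ n, x ∈ PiNat.cylinder (d n) (l n)) ∧ Tendsto d atTop (𝓝 x) := by
  have hev : ∀ i, ∃ M, ∀ n ≥ M, d n i = d M i := by
    intro i
    by_cases hl : ∃ M, i < l M
    · obtain ⟨M, hM⟩ := hl
      exact ⟨M, fun n hn => (walk_mono h hn).2.1 i hM⟩
    · push Not at hl
      -- the lengths are bounded, so they and the points are eventually constant
      obtain ⟨M, hM⟩ : ∃ M, ∀ n, l n ≤ l M := by
        have hbd : BddAbove (range l) := ⟨i, by rintro _ ⟨n, rfl⟩; exact hl n⟩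
        obtain ⟨M, hM⟩ := Nat.sSup_mem (range_nonempty l) hbd
        exact ⟨M, fun n => hM ▸ le_csSup hbd (mem_range_self n)⟩
      refine ⟨M, fun n hn => ?_⟩
      rw [(walk_mono h hn).2.2 (le_antisymm (hM n) (walk_mono h hn).1)]
  choose M hM using hev
  have hlim : Tendsto d atTop (𝓝 fun i => d (M i) i) := by
    refine tendsto_pi_nhds.2 fun i => tendsto_nhds_of_eventually_eq ?_
    exact eventually_atTop.2 ⟨M i, hM i⟩
  refine ⟨_, hE.mem_of_tendsto hlim (Eventually.of_forall fun n => walk_mem hd₀ _ (h n)),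
    fun n i hi => ?_, hlim⟩
  show d (M i) i = d n i
  rw [← hM i (max n (M i)) (le_max_right _ _)]
  exact (walk_mono h (le_max_left _ _)).2.1 i hi

theorem Tracks.eq_of_walk {z : Cantor} {x : Baire} (ht : Tracks E d₀ z x) {n : ℕ} {p : Baire × ℕ}
    (h : (walk E d₀ (PiNat.res z n)).1 = some p) : x ∈ PiNat.cylinder p.1 p.2 := by
  obtain ⟨d, l, h1, h2, -⟩ := ht
  rw [h1 n] at h
  obtain rfl := Option.some.inj h
  exact h2 n

theorem Tracks.exists_walk {z : Cantor} {x : Baire} (ht : Tracks E d₀ z x) (n : ℕ) :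
    ∃ p, (walk E d₀ (PiNat.res z n)).1 = some p := by
  obtain ⟨d, l, h1, -⟩ := ht
  exact ⟨_, h1 n⟩

/-- Two branches that separate at an entry cannot track the same point: the one that turns to a
child at this entry determines where its point leaves the node. -/
theorem Tracks.false_of_ne {z₁ z₂ : Cantor} {x : Baire} (h₁ : Tracks E d₀ z₁ x)
    (h₂ : Tracks E d₀ z₂ x) {n : ℕ} (hn : PiNat.res z₁ n = PiNat.res z₂ n) (hz₁ : z₁ n = false)
    (hz₂ : z₂ n = true) : False := by
  obtain ⟨p₂, hp₂⟩ := h₂.exists_walk (n + 1)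
  obtain ⟨q, hq, ⟨h, -⟩ | ⟨-, hc⟩⟩ := walk_succ hp₂
  · rw [hz₂] at h
    cases h
  have hx₂ := h₂.eq_of_walk hp₂
  rw [← hn] at hq hc
  -- the first branch never turns to a child of the node `q`
  have hall : ∀ i, walk E d₀ (PiNat.res z₁ (n + i)) =
      (some q, (walk E d₀ (PiNat.res z₁ n)).2 + i) ∧ z₁ (n + i) = false := by
    intro i
    induction i with
    | zero => exact ⟨Prod.ext hq rfl, hz₁⟩
    | succ i ih =>
      have hw : walk E d₀ (PiNat.res z₁ (n + (i + 1))) =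
          (some q, (walk E d₀ (PiNat.res z₁ n)).2 + (i + 1)) := by
        rw [← add_assoc, PiNat.res_succ, ih.2, walk, ih.1]
        rfl
      refine ⟨hw, ?_⟩
      by_contra hz
      rw [Bool.not_eq_false] at hz
      obtain ⟨p₁, hp₁⟩ := h₁.exists_walk (n + (i + 1) + 1)
      obtain ⟨q', hq', ⟨h, -⟩ | ⟨-, hc'⟩⟩ := walk_succ hp₁
      · rw [hz] at h
        cases h
      rw [hw] at hq' hc'
      obtain rfl := Option.some.inj hq'
      have := child_unique hc hc' hx₂ (h₁.eq_of_walk hp₁)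
      omega
  have hxq : x = q.1 := by
    obtain ⟨d, l, hd, -, hlim⟩ := h₁
    refine tendsto_nhds_unique hlim (tendsto_nhds_of_eventually_eq ?_)
    refine eventually_atTop.2 ⟨n, fun m hm => ?_⟩
    obtain ⟨i, rfl⟩ := Nat.exists_eq_add_of_le hm
    have := hd (n + i)
    rw [(hall i).1] at this
    exact (congrArg Prod.fst (Option.some.inj this)).symm
  exact (child_spec hc hx₂).2.2 (by rw [hxq])

theorem Tracks.unique {z₁ z₂ : Cantor} {x : Baire} (h₁ : Tracks E d₀ z₁ x)
    (h₂ : Tracks E d₀ z₂ x) : z₁ = z₂ := by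
  by_contra hne
  have hres : PiNat.res z₁ (PiNat.firstDiff z₁ z₂) = PiNat.res z₂ (PiNat.firstDiff z₁ z₂) :=
    PiNat.res_eq_res.2 fun i hi => PiNat.apply_eq_of_lt_firstDiff hi
  have hdiff := PiNat.apply_firstDiff_ne hne
  cases h : z₁ (PiNat.firstDiff z₁ z₂) with
  | false =>
    refine h₁.false_of_ne h₂ hres h ?_
    rw [h] at hdiff
    simpa using hdiff.symm
  | true =>
    refine h₂.false_of_ne h₁ hres.symm ?_ h
    rw [h] at hdiff
    simpa using hdiff.symm

open Classical in
/-- The word of length `n` whose entries lead to `x`: an entry is `true` if and only if it leads to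
a child that contains `x`. -/
noncomputable def guide (E : Set Baire) (d₀ x : Baire) : ℕ → List Bool
  | 0 => []
  | n + 1 => decide (∃ p, (walk E d₀ (true :: guide E d₀ x n)).1 = some p ∧
      x ∈ PiNat.cylinder p.1 p.2) :: guide E d₀ x n

/-- Every point of `E` is tracked by a branch. If this branch turns to a child only finitely often,
then the point is the one carried by the last node, as it lies in none of the children. -/
theorem exists_tracks (hE : IsClosed E) (hd₀ : d₀ ∈ E) {x : Baire} (hx : x ∈ E) :
    ∃ z, Tracks E d₀ z x := by
  classical
  set z : Cantor := fun n => decide (∃ p, (walk E d₀ (true :: guide E d₀ x n)).1 = some p ∧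
      x ∈ PiNat.cylinder p.1 p.2) with hz
  have hres : ∀ n, PiNat.res z n = guide E d₀ x n := by
    intro n
    induction n with
    | zero => rfl
    | succ n ih => rw [PiNat.res_succ, ih, guide]
  -- all children that have been passed do not contain `x`
  have hinv : ∀ n, ∃ p, (walk E d₀ (PiNat.res z n)).1 = some p ∧ x ∈ PiNat.cylinder p.1 p.2 ∧
      ∀ m < (walk E d₀ (PiNat.res z n)).2, ∀ p', child E p m = some p' →
        x ∉ PiNat.cylinder p'.1 p'.2 := by
    intro n
    induction n with
    | zero =>
      refine ⟨(d₀, 0), rfl, by simp, fun m hm => ?_⟩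
      exact absurd hm (Nat.not_lt_zero m)
    | succ n ih =>
      obtain ⟨p, hp, hxp, hm⟩ := ih
      by_cases hc : ∃ p, (walk E d₀ (true :: guide E d₀ x n)).1 = some p ∧
          x ∈ PiNat.cylinder p.1 p.2
      · obtain ⟨p', hp', hxp'⟩ := hc
        have hzn : z n = true := decide_eq_true ⟨p', hp', hxp'⟩
        rw [PiNat.res_succ, hzn, hres n]
        exact ⟨p', hp', hxp', fun m hm => absurd hm (Nat.not_lt_zero m)⟩
      · have hzn : z n = false := decide_eq_false hc
        rw [PiNat.res_succ, hzn]
        refine ⟨p, hp, hxp, fun m hm' p' hp' hxp' => ?_⟩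
        rcases Nat.lt_succ_iff_lt_or_eq.1 hm' with hlt | rfl
        · exact hm m hlt p' hp' hxp'
        · refine hc ⟨p', ?_, hxp'⟩
          rw [← hres n, walk, hp]
          exact hp'
  choose p hp hxp hpass using hinv
  obtain ⟨x', hx'E, hx', hlim⟩ := exists_tracks_of_walk hE hd₀ (z := z)
    (d := fun n => (p n).1) (l := fun n => (p n).2) hp
  suffices hxx : x' = x from ⟨z, _, _, hp, hxp, hxx ▸ hlim⟩
  have hmono := fun {n m : ℕ} (hm : n ≤ m) => walk_mono (E := E) (d₀ := d₀) (z := z)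
    (d := fun n => (p n).1) (l := fun n => (p n).2) hp hm
  by_cases hl : ∀ i, ∃ n, i < (p n).2
  · funext i
    obtain ⟨n, hn⟩ := hl i
    rw [hx' n i hn, hxp n i hn]
  · -- the nodes are eventually constant, and all children of the last one are passed
    push Not at hl
    obtain ⟨i, hi⟩ := hl
    obtain ⟨M, hM⟩ : ∃ M, ∀ n, (p n).2 ≤ (p M).2 := by
      have hbd : BddAbove (range fun n => (p n).2) := ⟨i, by rintro _ ⟨n, rfl⟩; exact hi n⟩
      obtain ⟨M, hM⟩ := Nat.sSup_mem (range_nonempty fun n => (p n).2) hbd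
      exact ⟨M, fun n => le_of_le_of_eq (le_csSup hbd (mem_range_self n)) hM.symm⟩
    have hconst : ∀ n ≥ M, p n = p M := fun n hn =>
      Prod.ext ((hmono hn).2.2 (le_antisymm (hM n) (hmono hn).1))
        (le_antisymm (hM n) (hmono hn).1)
    have hcount : ∀ j, (walk E d₀ (PiNat.res z (M + j))).2 =
        (walk E d₀ (PiNat.res z M)).2 + j := by
      intro j
      induction j with
      | zero => rfl
      | succ j ih =>
        obtain ⟨q, hq, ⟨hzf, -⟩ | ⟨-, hc⟩⟩ := walk_succ (hp (M + j + 1))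
        · rw [← add_assoc, PiNat.res_succ, hzf, walk, ih]
          rfl
        · rw [hp (M + j)] at hq
          obtain rfl := Option.some.inj hq
          have := (child_eq_some hc).2.1
          rw [hconst (M + j) (by omega), hconst (M + j + 1) (by omega)] at this
          omega
    have hxM : x' = (p M).1 := by
      refine tendsto_nhds_unique hlim (tendsto_nhds_of_eventually_eq ?_)
      exact eventually_atTop.2 ⟨M, fun n hn => by rw [hconst n hn]⟩
    rw [hxM]
    by_contra hne
    obtain ⟨m, p', hp', hxp'⟩ := exists_child hx (hxp M) (Ne.symm hne)
    refine hpass (M + (m + 1)) m (by rw [hcount]; omega) p' ?_ hxp'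
    rw [hconst (M + (m + 1)) (by omega)]
    exact hp'

end Walk

/-- The image of a closed subset of the Baire space under a continuous function to `(0, 1)` is
the set of densities in `(0, 1)` of a solid compact set, with each density attained only once if the
function is injective. -/
theorem exists_solid_of_isClosed {E : Set Baire} (hE : IsClosed E) {f : Baire → ℝ}
    (hf : ContinuousOn f E) (h01 : ∀ x ∈ E, f x ∈ Ioo (0 : ℝ) 1) :
    ∃ K : Hyperspace, K ∈ Sld ∧ (∀ t ∈ Ioo (0 : ℝ) 1, (∃ z, HasDensity K z t) ↔ t ∈ f '' E) ∧
      (InjOn f E → K ∈ RngInj) := by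
  rcases E.eq_empty_or_nonempty with rfl | ⟨d₀, hd₀⟩
  · obtain ⟨K, hK, h1, h2⟩ := exists_solid_of_tendsto (r := fun _ => 0) (g := fun _ => 0)
      (fun _ => ⟨le_rfl, one_pos⟩) (fun _ => tendsto_const_nhds)
    refine ⟨K, hK, fun t ht => ?_, fun _ => h2 ?_⟩
    · rw [h1 t ht]
      simp [ht.1.ne]
    · rintro z ⟨hz, -⟩
      exact absurd hz (lt_irrefl _)
  set r : List Bool → ℝ := fun w => ((walk E d₀ w).1.map fun p => f p.1).getD 0 with hr
  have hval : ∀ z, ∃ t, Tendsto (fun n => r (PiNat.res z n)) atTop (𝓝 t) ∧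
      ((∃ x ∈ E, Tracks E d₀ z x ∧ t = f x) ∨ t = 0) := by
    intro z
    by_cases h : ∃ n, (walk E d₀ (PiNat.res z n)).1 = none
    · obtain ⟨n, hn⟩ := h
      refine ⟨0, tendsto_const_nhds.congr' (eventually_atTop.2 ⟨n, fun m hm => ?_⟩), Or.inr rfl⟩
      simp [hr, walk_none hn hm]
    · push Not at h
      choose p hp using fun n => Option.ne_none_iff_exists'.1 (h n)
      obtain ⟨x, hxE, hx, hlim⟩ := exists_tracks_of_walk hE hd₀ (z := z)
        (d := fun n => (p n).1) (l := fun n => (p n).2) hp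
      refine ⟨f x, ?_, Or.inl ⟨x, hxE, ⟨_, _, hp, hx, hlim⟩, rfl⟩⟩
      have h1 : Tendsto (fun n => f (p n).1) atTop (𝓝 (f x)) := by
        refine (hf x hxE).tendsto.comp (tendsto_nhdsWithin_iff.2 ⟨hlim, ?_⟩)
        exact Eventually.of_forall fun n => walk_mem hd₀ _ (hp n)
      refine h1.congr fun n => ?_
      simp [hr, hp n]
  choose g hg hg' using hval
  obtain ⟨K, hK, h1, h2⟩ := exists_solid_of_tendsto (r := r) (g := g) (fun w => by
    cases h : (walk E d₀ w).1 with
    | none => simp [hr, h]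
    | some p =>
      have := h01 p.1 (walk_mem hd₀ w h)
      simp [hr, h, this.1.le, this.2]) hg
  refine ⟨K, hK, fun t ht => ?_, fun hinj => h2 ?_⟩
  · rw [h1 t ht]
    constructor
    · rintro ⟨z, rfl⟩
      rcases hg' z with ⟨x, hxE, -, hx⟩ | h0
      · exact ⟨x, hxE, hx.symm⟩
      · exact absurd h0 ht.1.ne'
    · rintro ⟨x, hxE, rfl⟩
      obtain ⟨z, hz⟩ := exists_tracks hE hd₀ hxE
      refine ⟨z, ?_⟩
      obtain ⟨d, l, hd, -, hlim⟩ := hz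
      have h3 : Tendsto (fun n => f (d n)) atTop (𝓝 (f x)) := by
        refine (hf x hxE).tendsto.comp (tendsto_nhdsWithin_iff.2 ⟨hlim, ?_⟩)
        exact Eventually.of_forall fun n => walk_mem hd₀ _ (hd n)
      refine tendsto_nhds_unique (hg z) (h3.congr fun n => ?_)
      simp [hr, hd n]
  · intro z₁ hz₁ z₂ hz₂ he
    rcases hg' z₁ with ⟨x₁, hx₁E, ht₁, hx₁⟩ | h0
    · rcases hg' z₂ with ⟨x₂, hx₂E, ht₂, hx₂⟩ | h0
      · have : x₁ = x₂ := hinj hx₁E hx₂E (by rw [← hx₁, ← hx₂, he])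
        subst this
        exact ht₁.unique ht₂
      · exact absurd h0 hz₂.1.ne'
    · exact absurd h0 hz₁.1.ne'

/-! ### Borel sets as injective continuous images of closed subsets of the Baire space -/

/-- `B` is the image of a closed subset of the Baire space under a continuous function that is
injective on this closed set. -/
def IsInjImage (B : Set Baire) : Prop :=
  ∃ (E : Set Baire) (f : Baire → Baire), IsClosed E ∧ Continuous f ∧ InjOn f E ∧ f '' E = B

theorem IsClosed.isInjImage {B : Set Baire} (hB : IsClosed B) : IsInjImage B :=
  ⟨B, id, hB, continuous_id, injOn_id B, image_id B⟩

/-- A point of the intersection is coded by the sequence of its codes in the given sets. -/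
theorem IsInjImage.iInter {B : ℕ → Set Baire} (hB : ∀ n, IsInjImage (B n)) :
    IsInjImage (⋂ n, B n) := by
  choose E f hE hf hinj him using hB
  have hcol : ∀ n, Continuous fun (x : Baire) (k : ℕ) => x (Nat.pair n k) := fun n =>
    continuous_pi fun k => continuous_apply _
  refine ⟨⋂ n, {x | (fun k => x (Nat.pair n k)) ∈ E n ∧
    f n (fun k => x (Nat.pair n k)) = f 0 (fun k => x (Nat.pair 0 k))},
    fun x => f 0 fun k => x (Nat.pair 0 k), ?_, (hf 0).comp (hcol 0), ?_, ?_⟩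
  · refine isClosed_iInter fun n => ((hE n).preimage (hcol n)).inter ?_
    exact isClosed_eq ((hf n).comp (hcol n)) ((hf 0).comp (hcol 0))
  · intro x hx y hy hxy
    rw [mem_iInter] at hx hy
    funext m
    have := hinj m.unpair.1 (hx _).1 (hy _).1 (((hx _).2.trans hxy).trans (hy _).2.symm)
    have := congrFun this m.unpair.2
    simpa using this
  · ext b
    constructor
    · rintro ⟨x, hx, rfl⟩
      rw [mem_iInter] at hx ⊢
      intro n
      rw [← him n]
      exact ⟨_, (hx n).1, (hx n).2⟩
    · intro hb
      rw [mem_iInter] at hb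
      have : ∀ n, ∃ x ∈ E n, f n x = b := fun n => by
        have := hb n
        rwa [← him n] at this
      choose x hx hxb using this
      refine ⟨fun m => x m.unpair.1 m.unpair.2, mem_iInter.2 fun n => ?_, ?_⟩ <;> simp [hx, hxb]

/-- A point of the disjoint union is coded by the index of its set followed by its code there. -/
theorem IsInjImage.iUnion {B : ℕ → Set Baire} (hB : ∀ n, IsInjImage (B n))
    (hd : Pairwise (Function.onFun Disjoint B)) : IsInjImage (⋃ n, B n) := by
  choose E f hE hf hinj him using hB
  have htail : Continuous fun (x : Baire) (k : ℕ) => x (k + 1) :=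
    continuous_pi fun k => continuous_apply _
  have hmem : ∀ n, ∀ x ∈ E n, f n x ∈ B n := fun n x hx => him n ▸ mem_image_of_mem _ hx
  refine ⟨⋂ n, {x | x 0 ≠ n} ∪ {x | (fun k => x (k + 1)) ∈ E n},
    fun x => f (x 0) fun k => x (k + 1), ?_, ?_, ?_, ?_⟩
  · refine isClosed_iInter fun n => IsClosed.union ?_ ((hE n).preimage htail)
    have h0 : Continuous fun x : Baire => x 0 := continuous_apply 0
    exact (isClosed_discrete {m : ℕ | m ≠ n}).preimage h0
  · have : Continuous fun p : ℕ × Baire => f p.1 p.2 := continuous_prod_of_discrete_left.2 hf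
    exact this.comp ((continuous_apply 0).prodMk htail)
  · intro x hx y hy hxy
    rw [mem_iInter] at hx hy
    have hx' := (hx (x 0)).resolve_left fun h => h rfl
    have hy' := (hy (y 0)).resolve_left fun h => h rfl
    have h0 : x 0 = y 0 := by
      by_contra hne
      refine Set.disjoint_left.1 (hd hne) (hmem _ _ hx') ?_
      have := hmem _ _ hy'
      rwa [← show f (x 0) (fun k => x (k + 1)) = f (y 0) fun k => y (k + 1) from hxy] at this
    have hxy' : f (x 0) (fun k => x (k + 1)) = f (x 0) fun k => y (k + 1) := by
      conv_rhs => rw [h0]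
      exact hxy
    rw [← h0] at hy'
    have := hinj (x 0) hx' hy' hxy'
    funext k
    cases k with
    | zero => exact h0
    | succ k => exact congrFun this k
  · ext b
    constructor
    · rintro ⟨x, hx, rfl⟩
      rw [mem_iInter] at hx
      exact mem_iUnion.2 ⟨x 0, hmem _ _ ((hx (x 0)).resolve_left fun h => h rfl)⟩
    · intro hb
      obtain ⟨n, hn⟩ := mem_iUnion.1 hb
      rw [← him n] at hn
      obtain ⟨x, hx, rfl⟩ := hn
      refine ⟨fun k => Nat.casesOn k n x, mem_iInter.2 fun m => ?_, rfl⟩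
      by_cases h : n = m
      · exact Or.inr (h ▸ hx)
      · exact Or.inl h

/-- By induction on Borel sets, simultaneously for the set and its complement; countable unions are
made disjoint by means of countable intersections. -/
theorem isInjImage_of_measurableSet {B : Set Baire} (hB : MeasurableSet B) : IsInjImage B := by
  suffices IsInjImage B ∧ IsInjImage Bᶜ from this.1
  rw [BorelSpace.measurable_eq (α := Baire),
    (PiNat.isTopologicalBasis_cylinders fun _ : ℕ => ℕ).borel_eq_generateFrom] at hB
  induction B, hB using MeasurableSpace.generateFrom_induction with
  | hC s hs _ =>
    obtain ⟨x, n, rfl⟩ := hs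
    refine ⟨IsClosed.isInjImage ?_, IsClosed.isInjImage (PiNat.isOpen_cylinder _ x n).isClosed_compl⟩
    rw [PiNat.cylinder_eq_pi]
    exact isClosed_set_pi fun i _ => isClosed_singleton
  | empty => exact ⟨IsClosed.isInjImage isClosed_empty, IsClosed.isInjImage (by simp)⟩
  | compl s _ ih => exact ⟨ih.2, by rw [compl_compl]; exact ih.1⟩
  | iUnion s _ ih =>
    constructor
    · rw [← iUnion_disjointed]
      refine IsInjImage.iUnion (fun n => ?_) (disjoint_disjointed s)
      have : disjointed s n = ⋂ m, if m < n then (s m)ᶜ else s n := by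
        ext x
        rw [disjointed_apply, mem_iInter]
        constructor
        · intro hx m
          split_ifs with hm
          · exact fun h => hx.2 (by simpa using ⟨m, hm, h⟩)
          · exact hx.1
        · intro hx
          refine ⟨by simpa using hx n, fun h => ?_⟩
          simp only [Finset.sup_set_eq_biUnion, mem_iUnion, Finset.mem_Iio] at h
          obtain ⟨m, hm, h⟩ := h
          have := hx m
          rw [if_pos hm] at this
          exact this h
      rw [this]
      refine IsInjImage.iInter fun m => ?_
      split_ifs
      · exact (ih m).2
      · exact (ih n).1
    · rw [compl_iUnion]
      exact IsInjImage.iInter fun n => (ih n).2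

/-- Reduction to the Baire space: a Polish space embeds into it by `x ↦ (n ↦ 1 if x ∈ B n else 0)`,
where `B` enumerates a basis. The images of Borel sets are Borel by the theorem of Lusin and
Souslin, and the inverse is continuous. -/
theorem exists_isClosed_injOn_image {X : Type} [TopologicalSpace X] [PolishSpace X]
    [MeasurableSpace X] [BorelSpace X] [hX : Nonempty X] {S : Set X} (hS : MeasurableSet S) :
    ∃ (E : Set Baire) (f : Baire → X), IsClosed E ∧ ContinuousOn f E ∧ InjOn f E ∧ f '' E = S := by
  classical
  obtain ⟨b, hbc, -, hb⟩ := exists_countable_basis X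
  have hbne : b.Nonempty := by
    obtain ⟨u, hu, -⟩ := hb.exists_subset_of_mem_open (mem_univ hX.some) isOpen_univ
    exact ⟨u, hu⟩
  obtain ⟨B, rfl⟩ := hbc.exists_eq_range hbne
  have hBo : ∀ n, IsOpen (B n) := fun n => hb.isOpen (mem_range_self n)
  set χ : X → Baire := fun x n => if x ∈ B n then 1 else 0 with hχ
  have hχm : Measurable χ := measurable_pi_iff.2 fun n =>
    Measurable.ite (hBo n).measurableSet measurable_const measurable_const
  have hχi : Function.Injective χ := by
    intro x y hxy
    by_contra hne
    obtain ⟨u, ⟨n, rfl⟩, hx, hy⟩ := hb.exists_subset_of_mem_open (u := {y}ᶜ)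
      (show x ∈ ({y}ᶜ : Set X) from hne) isOpen_compl_singleton
    have := congrFun hxy n
    simp only [hχ, hx, if_true] at this
    by_cases hyB : y ∈ B n
    · exact hy hyB rfl
    · simp [hyB] at this
  obtain ⟨E, f, hE, hf, hinj, him⟩ :=
    isInjImage_of_measurableSet (hS.image_of_measurable_injOn hχm hχi.injOn)
  have hval : ∀ x ∈ E, ∃ s ∈ S, χ s = f x := fun x hx => by
    have := mem_image_of_mem f hx
    rwa [him] at this
  have hinv : ∀ s, Function.invFun χ (χ s) = s := Function.leftInverse_invFun hχi
  refine ⟨E, fun x => Function.invFun χ (f x), hE, ?_, ?_, ?_⟩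
  · intro x hx
    obtain ⟨s, -, hs⟩ := hval x hx
    show Tendsto _ _ _
    simp only [← hs, hinv]
    refine hb.nhds_hasBasis.tendsto_right_iff.2 ?_
    rintro _ ⟨⟨n, rfl⟩, hsn⟩
    have hopen : ∀ᶠ y in 𝓝[E] x, f y n = f x n :=
      ((continuous_apply n).comp hf).continuousAt.continuousWithinAt.tendsto.eventually
        ((isOpen_discrete {f x n}).mem_nhds rfl)
    filter_upwards [hopen, self_mem_nhdsWithin] with y hy hyE
    obtain ⟨t, -, ht⟩ := hval y hyE
    rw [← ht, hinv]
    rw [← ht, ← hs] at hy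
    by_contra hcon
    simp [hχ, hsn, hcon] at hy
  · intro x hx y hy hxy
    obtain ⟨s, -, hs⟩ := hval x hx
    obtain ⟨t, -, ht⟩ := hval y hy
    refine hinj hx hy ?_
    simp only [← hs, ← ht, hinv] at hxy ⊢
    rw [hxy]
  · ext s
    constructor
    · rintro ⟨x, hx, rfl⟩
      obtain ⟨s, hs, hsx⟩ := hval x hx
      simpa [← hsx, hinv] using hs
    · intro hs
      have := mem_image_of_mem χ hs
      rw [← him] at this
      obtain ⟨x, hx, hxs⟩ := this
      exact ⟨x, hx, by simp [hxs, hinv]⟩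

/-! ### The sections of `𝒰` -/

/-- Suslin's theorem. -/
theorem boldDelta11_iff_measurableSet {X : Type} [TopologicalSpace X] [PolishSpace X]
    [MeasurableSpace X] [BorelSpace X] {S : Set X} : BoldDelta11 S ↔ MeasurableSet S :=
  ⟨fun h => h.1.measurableSet_of_compl h.2, fun h => ⟨h.analyticSet, h.compl.analyticSet⟩⟩

theorem exists_solid_vsection_eq {E : Set Baire} (hE : IsClosed E) {f : Baire → UnitOpen}
    (hf : ContinuousOn f E) :
    ∃ K ∈ Sld, vsection 𝒰 K = f '' E ∧ (InjOn f E → K ∈ RngInj) := by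
  obtain ⟨K, hK, h1, h2⟩ := exists_solid_of_isClosed hE (f := fun x => (f x : ℝ))
    (continuous_subtype_val.comp_continuousOn hf) fun x _ => (f x).2
  refine ⟨K, hK, ?_, fun h => h2 (Subtype.val_injective.comp_injOn h)⟩
  ext t
  refine (h1 t t.2).trans ?_
  simp [Subtype.ext_iff]

instance : Nonempty UnitOpen := ⟨⟨1 / 2, by norm_num, by norm_num⟩⟩

theorem exists_solid_of_analyticSet {S : Set UnitOpen} (hS : AnalyticSet S) :
    ∃ K ∈ Sld, vsection 𝒰 K = S := by
  rw [AnalyticSet] at hS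
  rcases hS with rfl | ⟨f, hf, rfl⟩
  · obtain ⟨K, hK, h, -⟩ := exists_solid_vsection_eq isClosed_empty
      (f := fun _ => Classical.arbitrary _) (by simp)
    exact ⟨K, hK, by simpa using h⟩
  · obtain ⟨K, hK, h, -⟩ := exists_solid_vsection_eq isClosed_univ hf.continuousOn
    exact ⟨K, hK, by simpa using h⟩

instance : PolishSpace UnitOpen := isOpen_Ioo.polishSpace

instance : PolishSpace Hyperspace := by
  let := metrizableSpaceMetric Hyperspace
  infer_instance

theorem exists_solid_injective_of_measurableSet {S : Set UnitOpen} (hS : MeasurableSet S) :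
    ∃ K ∈ Sld ∩ RngInj, vsection 𝒰 K = S := by
  obtain ⟨E, f, hE, hf, hinj, rfl⟩ := exists_isClosed_injOn_image hS
  obtain ⟨K, hK, h, h'⟩ := exists_solid_vsection_eq hE hf
  exact ⟨K, ⟨hK, h' hinj⟩, h⟩

/-- The density function of a solid compact set is Borel, as a limit of continuous functions, so
its injective image is Borel. -/
theorem measurableSet_vsection {K : Hyperspace} (hK : K ∈ Sld ∩ RngInj) :
    MeasurableSet (vsection 𝒰 K) := by
  obtain ⟨hs, hi⟩ := hK
  have hs' : ∀ z, ∃ r, HasDensity K z r := fun z => not_not.1 (hs z)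
  choose D hD using hs'
  have hDm : Measurable D := by
    refine measurable_of_tendsto_metrizable (f := fun n z => relMeasure K (PiNat.res z n)) ?_
      (tendsto_pi_nhds.2 fun z => hasDensity_iff.1 (hD z))
    intro n
    refine Continuous.measurable (continuous_iff_continuousAt.2 fun z => ?_)
    refine continuousAt_const.congr (f := fun _ => relMeasure K (PiNat.res z n)) ?_
    filter_upwards [(PiNat.isOpen_cylinder _ z n).mem_nhds (PiNat.self_mem_cylinder z n)] with y hy
    rw [PiNat.res_eq_res.2 fun i hi => hy i hi]
  have hB : MeasurableSet (D ⁻¹' Ioo 0 1) := hDm measurableSet_Ioo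
  have him : MeasurableSet (D '' (D ⁻¹' Ioo 0 1)) := by
    refine hB.image_of_measurable_injOn hDm fun z₁ h₁ z₂ _ he => ?_
    exact hi z₁ z₂ (D z₁) h₁ (hD z₁) (he ▸ hD z₂)
  have : vsection 𝒰 K = Subtype.val ⁻¹' (D '' (D ⁻¹' Ioo 0 1)) := by
    ext t
    constructor
    · rintro ⟨z, hz⟩
      have : D z = t := (hD z).unique hz
      exact ⟨z, by rw [mem_preimage, this]; exact t.2, this⟩
    · rintro ⟨z, -, hz⟩
      exact ⟨z, by rw [← hz]; exact hD z⟩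
  rw [this]
  exact measurable_subtype_coe him

theorem LightSigma11.analyticSet {X : Type} [TopologicalSpace X] [PolishSpace X] [EffectiveBasis X]
    {A : Set X} (hA : LightSigma11 A) : AnalyticSet A := by
  obtain ⟨C, ⟨W, -, hW⟩, rfl⟩ := hA
  have hC : IsClosed C := by
    rw [← isOpen_compl_iff, hW]
    have : {x : X × Baire | ∃ c, W c ∧ x ∈ EffectiveBasis.nbhd c} =
        ⋃ c ∈ {c | W c}, EffectiveBasis.nbhd (X := X × Baire) c := by
      ext x
      simp
    rw [this]
    exact isOpen_biUnion fun c _ => EffectiveBasis.isBasis.isOpen (mem_range_self c)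
  have : {x | ∃ y : Baire, (x, y) ∈ C} = Prod.fst '' C := by
    ext x
    simp
  rw [this]
  exact hC.analyticSet.image_of_continuous continuous_fst

theorem vsection_compl {X Y : Type} (A : Set (X × Y)) (x : X) :
    vsection Aᶜ x = (vsection A x)ᶜ :=
  rfl

theorem analyticSet_vsection {X Y : Type} [TopologicalSpace X] [T2Space X] [TopologicalSpace Y]
    [PolishSpace Y] [T2Space (X × Y)] {A : Set (X × Y)} (hA : AnalyticSet A) (x : X) :
    AnalyticSet (vsection A x) :=
  hA.preimage (f := fun y => (x, y)) (by fun_prop)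

theorem parametrizes_iff {X Y : Type} {A : Set (X × Y)} {I : Set X} {Γ : Set (Set Y)} :
    Parametrizes A I Γ ↔ (∀ x ∈ I, vsection A x ∈ Γ) ∧ ∀ S ∈ Γ, ∃ x ∈ I, vsection A x = S := by
  have h : ∀ x ∈ I, vsection (A ∩ I ×ˢ univ) x = vsection A x := by
    intro x hx
    ext y
    simp [vsection, hx]
  unfold Parametrizes
  constructor
  · rintro rfl
    refine ⟨fun x hx => ⟨x, hx, (h x hx).symm⟩, ?_⟩
    rintro S ⟨x, hx, rfl⟩
    exact ⟨x, hx, (h x hx).symm⟩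
  · rintro ⟨h1, h2⟩
    ext S
    constructor
    · rintro ⟨x, hx, rfl⟩
      rw [h x hx]
      exact h1 x hx
    · intro hS
      obtain ⟨x, hx, rfl⟩ := h2 S hS
      exact ⟨x, hx, (h x hx).symm⟩

/-! ### Recursive functionals on the Baire space -/

section Rec

variable {α β γ δ : Type} [Primcodable α] [Primcodable β] [Primcodable γ] [Primcodable δ]

/-- `F` is a total recursive functional with an oracle in the Baire space. It is presented by a
primitive recursive `g` for which `g s a` is `some (F y a)` for every `y` extending `s` as soon as
`s` contains all values of the oracle that are used, and `none` before that. -/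
def RecFun (F : Baire → α → β) : Prop :=
  ∃ g : List ℕ → α → Option β, Primrec₂ g ∧
    (∀ s a v, g s a = some v → ∀ y ∈ nbhdSeq s, F y a = v) ∧
    ∀ y a, ∀ᶠ k in atTop, g ((List.range k).map y) a = some (F y a)

theorem RecFun.of_primrec {f : α → β} (hf : Primrec f) : RecFun fun _ => f :=
  ⟨fun _ a => some (f a), Primrec.option_some.comp (hf.comp Primrec.snd), by simp, by simp⟩

theorem RecFun.comp₂ {f : β → γ → δ} (hf : Primrec₂ f) {F : Baire → α → β} {G : Baire → α → γ}
    (hF : RecFun F) (hG : RecFun G) : RecFun fun y a => f (F y a) (G y a) := by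
  obtain ⟨g, hg, hs, hc⟩ := hF
  obtain ⟨g', hg', hs', hc'⟩ := hG
  refine ⟨fun s a => (g s a).bind fun b => (g' s a).map (f b), ?_, ?_, ?_⟩
  · refine Primrec.option_bind hg ?_
    refine Primrec.option_map (hg'.comp (Primrec.fst.comp Primrec.fst)
      (Primrec.snd.comp Primrec.fst)) ?_
    exact hf.comp (Primrec.snd.comp Primrec.fst) Primrec.snd
  · intro s a v h y hy
    obtain ⟨b, hb, h⟩ := Option.bind_eq_some_iff.1 h
    obtain ⟨c, hc, rfl⟩ := Option.map_eq_some_iff.1 h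
    simp only [hs s a b hb y hy, hs' s a c hc y hy]
  · intro y a
    filter_upwards [hc y a, hc' y a] with k hk hk'
    simp [hk, hk']

theorem RecFun.comp {f : β → γ} (hf : Primrec f) {F : Baire → α → β} (hF : RecFun F) :
    RecFun fun y a => f (F y a) :=
  RecFun.comp₂ (f := fun b _ => f b) (hf.comp Primrec.fst) hF hF

theorem RecFun.of_param {F : Baire → β → γ} (hF : RecFun F) {f : α → β} (hf : Primrec f) :
    RecFun fun y a => F y (f a) := by
  obtain ⟨g, hg, hs, hc⟩ := hF
  exact ⟨fun s a => g s (f a), hg.comp Primrec.fst (hf.comp Primrec.snd),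
    fun s a v h => hs s _ v h, fun y a => hc y _⟩

theorem mem_nbhdSeq_map_range (y : Baire) (k : ℕ) : y ∈ nbhdSeq ((List.range k).map y) := by
  intro i h
  simp

/-- The value of the oracle at a recursively given argument. -/
theorem RecFun.oracle {F : Baire → α → ℕ} (hF : RecFun F) : RecFun fun y a => y (F y a) := by
  obtain ⟨g, hg, hs, hc⟩ := hF
  refine ⟨fun s a => (g s a).bind fun i => s[i]?, ?_, ?_, ?_⟩
  · refine Primrec.option_bind hg ?_
    exact Primrec.list_getElem?.comp (Primrec.fst.comp Primrec.fst) Primrec.snd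
  · intro s a v h y hy
    obtain ⟨i, hi, h⟩ := Option.bind_eq_some_iff.1 h
    obtain ⟨hlt, rfl⟩ := List.getElem?_eq_some_iff.1 h
    simp only [hs s a i hi y hy]
    exact hy i hlt
  · intro y a
    filter_upwards [hc y a, eventually_gt_atTop (F y a)] with k hk hlt
    simp [hk, hlt]

/-- Decidable predicates with an oracle in the Baire space. -/
def RecPred (P : Baire → α → Prop) : Prop :=
  ∃ F : Baire → α → Bool, RecFun F ∧ ∀ y a, P y a ↔ F y a = true

theorem RecPred.of_primrecRel {R : β → γ → Prop} (hR : PrimrecRel R) {F : Baire → α → β}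
    {G : Baire → α → γ} (hF : RecFun F) (hG : RecFun G) :
    RecPred fun y a => R (F y a) (G y a) := by
  classical
  exact ⟨fun y a => decide (R (F y a) (G y a)), RecFun.comp₂ hR.decide hF hG, by simp⟩

theorem RecPred.not {P : Baire → α → Prop} (hP : RecPred P) : RecPred fun y a => ¬ P y a := by
  obtain ⟨F, hF, h⟩ := hP
  exact ⟨_, RecFun.comp Primrec.not hF, by simp [h]⟩

theorem RecPred.and {P Q : Baire → α → Prop} (hP : RecPred P) (hQ : RecPred Q) :
    RecPred fun y a => P y a ∧ Q y a := by
  obtain ⟨F, hF, h⟩ := hP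
  obtain ⟨G, hG, h'⟩ := hQ
  exact ⟨_, RecFun.comp₂ Primrec.and hF hG, by simp [h, h']⟩

theorem RecPred.or {P Q : Baire → α → Prop} (hP : RecPred P) (hQ : RecPred Q) :
    RecPred fun y a => P y a ∨ Q y a := by
  obtain ⟨F, hF, h⟩ := hP
  obtain ⟨G, hG, h'⟩ := hQ
  exact ⟨_, RecFun.comp₂ Primrec.or hF hG, by simp [h, h']⟩

theorem RecPred.imp {P Q : Baire → α → Prop} (hP : RecPred P) (hQ : RecPred Q) :
    RecPred fun y a => P y a → Q y a := by
  simpa only [imp_iff_not_or] using hP.not.or hQ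

theorem RecPred.of_param {P : Baire → β → Prop} (hP : RecPred P) {f : α → β} (hf : Primrec f) :
    RecPred fun y a => P y (f a) := by
  obtain ⟨F, hF, h⟩ := hP
  exact ⟨_, hF.of_param hf, fun y a => h y _⟩

/-- Lightface `Π⁰₁` predicates on the Baire space, in the form of a universal quantifier over a
decidable predicate. -/
def IsPi01 (Q : Baire → Prop) : Prop :=
  ∃ P : Baire → ℕ → Prop, RecPred P ∧ ∀ y, Q y ↔ ∀ n, P y n

theorem RecPred.isPi01 [Inhabited α] {P : Baire → α → Prop} (hP : RecPred P) :
    IsPi01 fun y => ∀ a, P y a := by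
  refine ⟨fun y n => P y ((Encodable.decode n).getD default),
    hP.of_param (Primrec.option_getD.comp Primrec.decode (Primrec.const _)), fun y => ?_⟩
  refine ⟨fun h n => h _, fun h a => ?_⟩
  simpa using h (Encodable.encode a)

theorem IsPi01.and {Q R : Baire → Prop} (hQ : IsPi01 Q) (hR : IsPi01 R) :
    IsPi01 fun y => Q y ∧ R y := by
  obtain ⟨P, hP, h⟩ := hQ
  obtain ⟨P', hP', h'⟩ := hR
  refine ⟨_, hP.and hP', fun y => ?_⟩
  simp only [h, h', forall_and]

/-- Two universal quantifiers over independent variables can be moved out of a disjunction. -/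
theorem IsPi01.or {Q R : Baire → Prop} (hQ : IsPi01 Q) (hR : IsPi01 R) :
    IsPi01 fun y => Q y ∨ R y := by
  obtain ⟨P, hP, h⟩ := hQ
  obtain ⟨P', hP', h'⟩ := hR
  have := ((hP.of_param (α := ℕ × ℕ) Primrec.fst).or (hP'.of_param Primrec.snd)).isPi01
  convert this using 2 with y
  rw [h, h']
  constructor
  · rintro (h | h) a
    · exact Or.inl (h _)
    · exact Or.inr (h _)
  · intro h
    by_contra! hcon
    obtain ⟨⟨n, hn⟩, ⟨m, hm⟩⟩ := hcon
    exact (h (n, m)).elim hn hm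

/-- The projection of a primitive recursive relation is recursively enumerable. -/
theorem rePred_exists {P : α → β → Prop} (hP : PrimrecRel P) : REPred fun a => ∃ b, P a b := by
  classical
  have h : Primrec₂ fun (a : α) (n : ℕ) =>
      (Encodable.decode (α := β) n).bind fun b => if P a b then some b else none := by
    refine Primrec.option_bind (Primrec.decode.comp Primrec.snd) ?_
    exact Primrec.ite (hP.comp (Primrec.fst.comp Primrec.fst) Primrec.snd)
      (Primrec.option_some.comp Primrec.snd) (Primrec.const none)
  refine (Partrec.dom_re (Partrec.rfindOpt h.to_comp)).of_eq fun a => ?_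
  rw [Nat.rfindOpt_dom]
  constructor
  · rintro ⟨n, b, hb⟩
    obtain ⟨c, -, hc⟩ := Option.bind_eq_some_iff.1 hb
    split_ifs at hc with h
    exact ⟨c, h⟩
  · rintro ⟨b, hb⟩
    exact ⟨Encodable.encode b, b, by simp [hb]⟩

end Rec

/-! ### Coding compact sets and reals by oracles -/

/-- The entries of `y` with first index `0` and second index `(u, 0)` tell which cylinders meet
the set `A`. -/
def CodesSet (y : Baire) (A : Set Cantor) : Prop :=
  ∀ u : List Bool, y (Nat.pair 0 (Encodable.encode (u, 0))) ≠ 0 ↔ (A ∩ cyl u).Nonempty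

/-- The entry of `y` with indices `(1, j)` approximates `r` from below up to `1 / (j + 1)`. -/
def CodesReal (y : Baire) (r : ℝ) : Prop :=
  ∀ j : ℕ, (y (Nat.pair 1 j) : ℝ) ≤ r * (j + 1) ∧ r * (j + 1) ≤ y (Nat.pair 1 j) + 1

theorem mem_nbhdSeq_reverse {x : Cantor} {u : List Bool} : x ∈ nbhdSeq u.reverse ↔ x ∈ cyl u := by
  induction u with
  | nil => simp [nbhdSeq, mem_cyl_nil]
  | cons b u ih =>
    rw [mem_cyl_cons, ← ih]
    simp only [nbhdSeq, mem_ofPred_eq, List.reverse_cons, List.length_append, List.length_reverse,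
      List.length_singleton]
    constructor
    · intro h
      refine ⟨?_, fun i hi => ?_⟩
      · have := h u.length (by omega)
        rw [List.getElem_append_right (by simp)] at this
        simpa using this
      · have := h i (by omega)
        rwa [List.getElem_append_left (by simpa using hi)] at this
    · rintro ⟨h0, h⟩ i hi
      rcases Nat.lt_succ_iff_lt_or_eq.1 hi with hi' | rfl
      · rw [List.getElem_append_left (by simpa using hi')]
        exact h i hi'
      · rw [List.getElem_append_right (by simp)]
        simpa using h0

theorem nbhdSeq_reverse (u : List Bool) : nbhdSeq u.reverse = cyl u := by
  ext x
  exact mem_nbhdSeq_reverse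

/-- The words `w` and `v` differ at an entry that both of them have. -/
def Incompatible (w v : List Bool) : Prop :=
  ∃ i < v.length, w[i]?.map not = v[i]?

theorem Incompatible.disjoint {w v : List Bool} (h : Incompatible w v) :
    Disjoint (nbhdSeq w) (nbhdSeq v) := by
  obtain ⟨i, hi, h⟩ := h
  rw [List.getElem?_eq_getElem hi] at h
  obtain ⟨b, hb, h⟩ := Option.map_eq_some_iff.1 h
  obtain ⟨hlt, rfl⟩ := List.getElem?_eq_some_iff.1 hb
  refine Set.disjoint_left.2 fun x h1 h2 => ?_
  have h1 := h1 i hlt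
  have h2 := h2 i hi
  rw [← h, ← h1] at h2
  simp at h2

theorem incompatible_of_ne {w v : List Bool} (hl : w.length = v.length) (h : w ≠ v) :
    Incompatible w v := by
  by_contra hcon
  refine h (List.ext_getElem hl fun i hi hi' => ?_)
  by_contra hne
  refine hcon ⟨i, hi', ?_⟩
  rw [List.getElem?_eq_getElem hi, List.getElem?_eq_getElem hi']
  cases hw : w[i] <;> cases hv : v[i] <;> simp_all

theorem primrecRel_incompatible : PrimrecRel Incompatible := by
  have h : PrimrecRel fun (i : ℕ) (p : List Bool × List Bool) => p.1[i]?.map not = p.2[i]? := by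
    refine PrimrecRel.comp Primrec.eq ?_ ?_
    · refine Primrec.option_map (Primrec.list_getElem?.comp
        (Primrec.fst.comp Primrec.snd) Primrec.fst) ?_
      exact Primrec.not.comp Primrec.snd
    · exact Primrec.list_getElem?.comp (Primrec.snd.comp Primrec.snd) Primrec.fst
  have h' := PrimrecRel.comp (f := fun p : List Bool × List Bool => List.range p.2.length)
    (g := fun p => p) h.exists_mem_list
    (Primrec.list_range.comp (Primrec.list_length.comp Primrec.snd)) Primrec.id
  exact h'.of_eq fun p => by simp [Incompatible]

/-- That a compact set misses a cylinder is witnessed by the basic neighbourhood given by all words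
of the same length whose cylinders meet the compact set. -/
theorem exists_nbhdHyperspace_disjoint {K : Hyperspace} {u : List Bool}
    (h : ¬ ((K : Set Cantor) ∩ cyl u).Nonempty) :
    ∃ L, K ∈ nbhdHyperspace L ∧ ∀ w ∈ L, Incompatible w u.reverse := by
  classical
  have hfin : {w : List Bool | w.length = u.length ∧ ((K : Set Cantor) ∩ nbhdSeq w).Nonempty}.Finite :=
    (List.finite_length_eq Bool u.length).subset fun w hw => hw.1
  refine ⟨hfin.toFinset.toList, ⟨fun x hx => ?_, fun w hw => ?_⟩, fun w hw => ?_⟩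
  · have hxc := self_mem_cyl_res x u.length
    rw [← nbhdSeq_reverse] at hxc
    refine mem_iUnion₂.2 ⟨(PiNat.res x u.length).reverse, ?_, hxc⟩
    simp only [Finset.mem_toList, Finite.mem_toFinset, mem_ofPred_eq, List.length_reverse,
      PiNat.res_length, true_and]
    exact ⟨x, hx, hxc⟩
  · simp only [Finset.mem_toList, Finite.mem_toFinset, mem_ofPred_eq] at hw
    exact hw.2
  · simp only [Finset.mem_toList, Finite.mem_toFinset, mem_ofPred_eq] at hw
    refine incompatible_of_ne (by simpa using hw.1) ?_
    rintro rfl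
    rw [nbhdSeq_reverse] at hw
    exact h hw.2

/-- The basic open sets on which one of the conditions `CodesSet y K`, `CodesReal y r` and
`∀ n, F y n = true` fails for all `((K, r), y)`, where `g` presents `F` as in `RecFun`. The index
`i = ((u, v), n)` tells which instance of these conditions fails. -/
def Refutes (g : List ℕ → ℕ → Option Bool) (c : (List (List Bool) × (ℕ × ℕ × ℕ)) × List ℕ)
    (i : (List Bool × ℕ) × ℕ) : Prop :=
  (c.2[Nat.pair 0 (Encodable.encode (i.1.1, 0))]? = some 0 ∧ i.1.1.reverse ∈ c.1.1) ∨
  (c.2[Nat.pair 0 (Encodable.encode (i.1.1, 0))]? = some (i.1.2 + 1) ∧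
    ∀ w ∈ c.1.1, Incompatible w i.1.1.reverse) ∨
  (c.2[Nat.pair 1 i.2]? = some i.1.2 ∧ c.1.2.2.1 * (i.2 + 1) ≤ i.1.2 * (c.1.2.2.2 + 1)) ∨
  (c.2[Nat.pair 1 i.2]? = some i.1.2 ∧ (i.1.2 + 1) * (c.1.2.2.2 + 1) ≤ c.1.2.1 * (i.2 + 1)) ∨
  g c.2 i.2 = some false

theorem primrecRel_refutes {g : List ℕ → ℕ → Option Bool} (hg : Primrec₂ g) :
    PrimrecRel (Refutes g) := by
  have hs : Primrec fun p : ((List (List Bool) × (ℕ × ℕ × ℕ)) × List ℕ) × ((List Bool × ℕ) × ℕ) =>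
      p.1.2 := Primrec.snd.comp Primrec.fst
  have hL : Primrec fun p : ((List (List Bool) × (ℕ × ℕ × ℕ)) × List ℕ) × ((List Bool × ℕ) × ℕ) =>
      p.1.1.1 := Primrec.fst.comp (Primrec.fst.comp Primrec.fst)
  have hq : Primrec fun p : ((List (List Bool) × (ℕ × ℕ × ℕ)) × List ℕ) × ((List Bool × ℕ) × ℕ) =>
      p.1.1.2 := Primrec.snd.comp (Primrec.fst.comp Primrec.fst)
  have hu : Primrec fun p : ((List (List Bool) × (ℕ × ℕ × ℕ)) × List ℕ) × ((List Bool × ℕ) × ℕ) =>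
      p.2.1.1 := Primrec.fst.comp (Primrec.fst.comp Primrec.snd)
  have hv : Primrec fun p : ((List (List Bool) × (ℕ × ℕ × ℕ)) × List ℕ) × ((List Bool × ℕ) × ℕ) =>
      p.2.1.2 := Primrec.snd.comp (Primrec.fst.comp Primrec.snd)
  have hn : Primrec fun p : ((List (List Bool) × (ℕ × ℕ × ℕ)) × List ℕ) × ((List Bool × ℕ) × ℕ) =>
      p.2.2 := Primrec.snd.comp Primrec.snd
  have hcell := Primrec.list_getElem?.comp hs (Primrec₂.natPair.comp (Primrec.const 0)
    (Primrec.encode.comp (Primrec.pair hu (Primrec.const 0))))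
  have hcell' := Primrec.list_getElem?.comp hs (Primrec₂.natPair.comp (Primrec.const 1) hn)
  have hrev := Primrec.list_reverse.comp hu
  refine PrimrecPred.or (PrimrecPred.and ?_ ?_) (PrimrecPred.or (PrimrecPred.and ?_ ?_)
    (PrimrecPred.or (PrimrecPred.and ?_ ?_) (PrimrecPred.or (PrimrecPred.and ?_ ?_) ?_)))
  · exact PrimrecRel.comp Primrec.eq hcell (Primrec.const (some 0))
  · have : PrimrecRel fun (L : List (List Bool)) (w : List Bool) => ∃ a ∈ L, a = w :=
      PrimrecRel.exists_mem_list Primrec.eq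
    exact (this.comp hL hrev).of_eq fun p => by simp
  · exact PrimrecRel.comp Primrec.eq hcell (Primrec.option_some.comp (Primrec.succ.comp hv))
  · exact (primrecRel_incompatible.forall_mem_list).comp hL hrev
  · exact PrimrecRel.comp Primrec.eq hcell' (Primrec.option_some.comp hv)
  · exact PrimrecRel.comp Primrec.nat_le
      (Primrec.nat_mul.comp (Primrec.fst.comp (Primrec.snd.comp hq)) (Primrec.succ.comp hn))
      (Primrec.nat_mul.comp hv (Primrec.succ.comp (Primrec.snd.comp (Primrec.snd.comp hq))))
  · exact PrimrecRel.comp Primrec.eq hcell' (Primrec.option_some.comp hv)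
  · exact PrimrecRel.comp Primrec.nat_le
      (Primrec.nat_mul.comp (Primrec.succ.comp hv)
        (Primrec.succ.comp (Primrec.snd.comp (Primrec.snd.comp hq))))
      (Primrec.nat_mul.comp (Primrec.fst.comp hq) (Primrec.succ.comp hn))
  · exact PrimrecRel.comp Primrec.eq (hg.comp hs hn) (Primrec.const (some false))

theorem getElem?_of_mem_nbhdSeq {y : Baire} {s : List ℕ} (hy : y ∈ nbhdSeq s) {i v : ℕ}
    (h : s[i]? = some v) : y i = v := by
  obtain ⟨hi, rfl⟩ := List.getElem?_eq_some_iff.1 h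
  exact hy i hi

/-- Existential quantification over codes of the point, subject to a lightface `Π⁰₁` condition on
the code, yields lightface `Σ¹₁` sets. -/
theorem lightSigma11_of_isPi01 {Q : Baire → Prop} (hQ : IsPi01 Q) :
    LightSigma11 {p : Hyperspace × UnitOpen |
      ∃ y, CodesSet y p.1 ∧ CodesReal y p.2 ∧ Q y} := by
  obtain ⟨P, ⟨F, ⟨g, hg, hs, hc⟩, hPF⟩, hP⟩ := hQ
  refine ⟨{x | CodesSet x.2 x.1.1 ∧ CodesReal x.2 x.1.2 ∧ Q x.2},
    ⟨fun c => ∃ i, Refutes g c i, rePred_exists (primrecRel_refutes hg), ?_⟩, rfl⟩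
  ext ⟨⟨K, r⟩, y⟩
  constructor
  · -- a condition that fails at a point fails on a basic neighbourhood
    intro h
    obtain ⟨L₀, hL₀⟩ : ∃ L, K ∈ nbhdHyperspace L := by
      obtain ⟨_, ⟨L, rfl⟩, hL, -⟩ := isTopologicalBasis_nbhdHyperspace.exists_subset_of_mem_open
        (mem_univ K) isOpen_univ
      exact ⟨L, hL⟩
    have hq₀ : r ∈ nbhdUnitOpen (0, 1, 0) := by
      have := r.2
      simp [nbhdUnitOpen, this.1, this.2]
    have hcell : ∀ m, ((List.range (m + 1)).map y)[m]? = some (y m) := fun m => by simp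
    have hy : ∀ m, y ∈ nbhdSeq ((List.range m).map y) := mem_nbhdSeq_map_range y
    by_cases h1 : CodesSet y K
    · by_cases h2 : CodesReal y r
      · have h3 : ¬ Q y := fun h3 => h ⟨h1, h2, h3⟩
        rw [hP] at h3
        push Not at h3
        obtain ⟨n, hn⟩ := h3
        rw [hPF, Bool.not_eq_true] at hn
        obtain ⟨k, hk⟩ := (hc y n).exists
        rw [hn] at hk
        exact ⟨((L₀, (0, 1, 0)), (List.range k).map y), ⟨(([], 0), n), by simp [Refutes, hk]⟩,
          ⟨hL₀, hq₀⟩, hy k⟩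
      · rw [CodesReal] at h2
        push Not at h2
        obtain ⟨j, hj⟩ := h2
        have hj1 : (0 : ℝ) < j + 1 := by positivity
        by_cases hlt : (y (Nat.pair 1 j) : ℝ) ≤ r * (j + 1)
        · refine ⟨((L₀, (y (Nat.pair 1 j) + 1, j + 1, j)), _),
            ⟨(([], y (Nat.pair 1 j)), j), ?_⟩, ⟨hL₀, ?_⟩, hy (Nat.pair 1 j + 1)⟩
          · simp [Refutes]
          · refine ⟨?_, ?_⟩
            · rw [div_lt_iff₀ hj1]
              push_cast
              exact hj hlt
            · push_cast
              rw [div_self hj1.ne']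
              exact r.2.2
        · refine ⟨((L₀, (0, y (Nat.pair 1 j), j)), _),
            ⟨(([], y (Nat.pair 1 j)), j), ?_⟩, ⟨hL₀, ?_⟩, hy (Nat.pair 1 j + 1)⟩
          · simp [Refutes]
          · refine ⟨?_, ?_⟩
            · simpa using r.2.1
            · rw [lt_div_iff₀ hj1]
              exact not_le.1 hlt
    · rw [CodesSet] at h1
      push Not at h1
      obtain ⟨u, hu⟩ := h1
      rcases hu with ⟨h0, hne⟩ | ⟨h0, hne⟩
      · obtain ⟨L, hL, hLu⟩ := exists_nbhdHyperspace_disjoint (K := K) (u := u)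
          (not_nonempty_iff_eq_empty.2 hne)
        obtain ⟨v, hv⟩ := Nat.exists_eq_succ_of_ne_zero h0
        refine ⟨((L, (0, 1, 0)), _), ⟨((u, v), 0), Or.inr (Or.inl ⟨?_, hLu⟩)⟩, ⟨hL, hq₀⟩,
          hy (Nat.pair 0 (Encodable.encode (u, 0)) + 1)⟩
        rw [hcell, hv]
      · refine ⟨(([u.reverse, []], (0, 1, 0)), _), ⟨((u, 0), 0), Or.inl ⟨?_, by simp⟩⟩,
          ⟨?_, hq₀⟩, hy (Nat.pair 0 (Encodable.encode (u, 0)) + 1)⟩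
        · rw [hcell, h0]
        · refine ⟨fun x _ => mem_iUnion₂.2 ⟨[], by simp, by simp [nbhdSeq]⟩, fun w hw => ?_⟩
          simp only [List.mem_cons, List.not_mem_nil, or_false] at hw
          rcases hw with rfl | rfl
          · rw [nbhdSeq_reverse]
            exact hne
          · exact hne.mono (inter_subset_inter_right _ fun x _ => by simp [nbhdSeq])
  · rintro ⟨⟨⟨L, a, b, c⟩, s⟩, ⟨⟨⟨u, v⟩, n⟩, hi⟩, ⟨hK, hr⟩, hy⟩ ⟨h1, h2, h3⟩
    have hc1 : (0 : ℝ) < c + 1 := by positivity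
    have hn1 : (0 : ℝ) < n + 1 := by positivity
    rcases hi with ⟨hcell, hu⟩ | ⟨hcell, hu⟩ | ⟨hcell, hle⟩ | ⟨hcell, hle⟩ | hfalse
    · refine (h1 u).2 ?_ (getElem?_of_mem_nbhdSeq hy hcell)
      rw [← nbhdSeq_reverse]
      exact hK.2 _ hu
    · have h0 : y (Nat.pair 0 (Encodable.encode (u, 0))) ≠ 0 := by
        have := getElem?_of_mem_nbhdSeq hy hcell
        exact fun h0 => Nat.succ_ne_zero v (this.symm.trans h0)
      obtain ⟨x, hxK, hxu⟩ := (h1 u).1 h0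
      rw [← nbhdSeq_reverse] at hxu
      obtain ⟨w, hw, hxw⟩ := mem_iUnion₂.1 (hK.1 hxK)
      exact Set.disjoint_left.1 (hu w hw).disjoint hxw hxu
    · have h4 := (h2 n).1
      rw [getElem?_of_mem_nbhdSeq hy hcell] at h4
      have h5 : (r : ℝ) * (c + 1) < b := (lt_div_iff₀ hc1).1 hr.2
      have h6 : (b : ℝ) * (n + 1) ≤ v * (c + 1) := by exact_mod_cast hle
      have h7 : (r : ℝ) * (c + 1) * (n + 1) < b * (n + 1) := by gcongr
      have h8 : (v : ℝ) * (c + 1) ≤ r * (n + 1) * (c + 1) := by gcongr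
      linarith [mul_right_comm (r : ℝ) (c + 1) (n + 1)]
    · have h4 := (h2 n).2
      rw [getElem?_of_mem_nbhdSeq hy hcell] at h4
      have h5 : (a : ℝ) < r * (c + 1) := (div_lt_iff₀ hc1).1 hr.1
      have h6 : ((v : ℝ) + 1) * (c + 1) ≤ a * (n + 1) := by exact_mod_cast hle
      have h7 : (a : ℝ) * (n + 1) < r * (c + 1) * (n + 1) := by gcongr
      have h8 : (r : ℝ) * (n + 1) * (c + 1) ≤ (v + 1) * (c + 1) := by gcongr
      linarith [mul_right_comm (r : ℝ) (c + 1) (n + 1)]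
    · have h4 := hs s n false hfalse y hy
      have h5 := (hPF y n).1 ((hP y).1 h3 n)
      rw [h4] at h5
      cases h5

/-! ### Approximating relative measures by counting cylinders -/

/-- The union of the cylinders of length `n` that meet `A`. -/
def fatten (A : Set Cantor) (n : ℕ) : Set Cantor :=
  {x | (A ∩ cyl (PiNat.res x n)).Nonempty}

open Classical in
/-- The number of extensions of `u` by `d` entries whose cylinders meet `A`. -/
noncomputable def count (A : Set Cantor) : ℕ → List Bool → ℕ
  | 0, u => if (A ∩ cyl u).Nonempty then 1 else 0
  | d + 1, u => count A d (false :: u) + count A d (true :: u)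

theorem count_eq (A : Set Cantor) (d : ℕ) (u : List Bool) :
    (count A d u : ℝ) = relMeasure (fatten A (u.length + d)) u * 2 ^ d := by
  induction d generalizing u with
  | zero =>
    have hmem : ∀ x ∈ cyl u, (x ∈ fatten A u.length ↔ (A ∩ cyl u).Nonempty) := by
      intro x hx
      rw [cyl, mem_ofPred_eq] at hx
      rw [fatten, mem_ofPred_eq, hx]
    by_cases h : (A ∩ cyl u).Nonempty
    · rw [add_zero, relMeasure_of_cyl_subset fun x hx => (hmem x hx).2 h]
      simp [count, h]
    · rw [add_zero, relMeasure_of_disjoint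
        (Set.disjoint_left.2 fun x hx hxu => h ((hmem x hxu).1 hx))]
      simp [count, h]
  | succ d ih =>
    rw [count, Nat.cast_add, ih, ih, relMeasure_eq u, pow_succ]
    simp only [List.length_cons, add_right_comm _ 1 d, add_assoc]
    ring

theorem subset_fatten (A : Set Cantor) (n : ℕ) : A ⊆ fatten A n := fun x hx =>
  ⟨x, hx, self_mem_cyl_res x n⟩

theorem relMeasure_le_count (A : Set Cantor) (d : ℕ) (u : List Bool) :
    relMeasure A u ≤ count A d u / 2 ^ d := by
  rw [count_eq, mul_div_cancel_right₀ _ (by positivity)]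
  exact relMeasure_mono (subset_fatten A _) u

theorem isClosed_fatten (A : Set Cantor) (n : ℕ) : IsClosed (fatten A n) := by
  have h : (fatten A n)ᶜ = ⋃ x ∈ (fatten A n)ᶜ, PiNat.cylinder x n := by
    ext y
    simp only [mem_iUnion, exists_prop]
    refine ⟨fun hy => ⟨y, hy, PiNat.self_mem_cylinder y n⟩, ?_⟩
    rintro ⟨x, hx, hy⟩ hyA
    rw [fatten, mem_ofPred_eq, PiNat.res_eq_res.2 fun i hi => hy i hi] at hyA
    exact hx hyA
  rw [← isOpen_compl_iff, h]
  exact isOpen_biUnion fun x _ => PiNat.isOpen_cylinder _ x n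

theorem fatten_antitone (A : Set Cantor) : Antitone (fatten A) := by
  rintro m n hmn x ⟨y, hyA, hy⟩
  refine ⟨y, hyA, ?_⟩
  rw [cyl_res] at hy ⊢
  exact PiNat.cylinder_anti x hmn hy

theorem iInter_fatten {A : Set Cantor} (hA : IsClosed A) : ⋂ n, fatten A n = A := by
  refine Subset.antisymm (fun x hx => ?_) (subset_iInter fun n => subset_fatten A n)
  by_contra hxA
  obtain ⟨n, hn⟩ := PiNat.exists_disjoint_cylinder hA hxA
  obtain ⟨y, hyA, hy⟩ := mem_iInter.1 hx n
  rw [cyl_res] at hy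
  exact Set.disjoint_left.1 hn hyA hy

theorem tendsto_count {A : Set Cantor} (hA : IsClosed A) (u : List Bool) :
    Tendsto (fun d => (count A d u : ℝ) / 2 ^ d) atTop (𝓝 (relMeasure A u)) := by
  have h : ∀ d, (count A d u : ℝ) / 2 ^ d = relMeasure (fatten A (d + u.length)) u := by
    intro d
    rw [count_eq, mul_div_cancel_right₀ _ (by positivity), add_comm]
  simp only [h]
  have hlim : Tendsto (fun n => relMeasure (fatten A n) u) atTop (𝓝 (relMeasure A u)) := by
    refine Tendsto.mul_const _ ?_
    have : A ∩ cyl u = ⋂ n, fatten A n ∩ cyl u := by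
      rw [← iInter_inter, iInter_fatten hA]
    rw [this]
    refine (ENNReal.tendsto_toReal (measure_ne_top _ _)).comp ?_
    refine tendsto_measure_iInter_atTop
      (fun n => ((isClosed_fatten A n).measurableSet.inter (measurableSet_cyl u)).nullMeasurableSet)
      (fun m n hmn => inter_subset_inter_left _ (fatten_antitone A hmn)) ⟨0, measure_ne_top _ _⟩
  exact hlim.comp (tendsto_add_atTop_nat _)

theorem exists_count_lt {A : Set Cantor} (hA : IsClosed A) (u : List Bool) {c : ℝ}
    (hc : relMeasure A u < c) : ∃ d, (count A d u : ℝ) / 2 ^ d < c :=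
  ((tendsto_count hA u).eventually_lt_const hc).exists

/-- The existence of the density at a point as a condition on the counts along the words `v n`: from
`N j` on, the relative measures lie in the interval from `(p j - 1) / (j + 1)` to
`(p j + 2) / (j + 1)`, the upper bound being witnessed by the counts at depth `κ j n`. -/
def Settles (h : ℕ → List Bool → ℕ) (v : ℕ → List Bool) (p N : ℕ → ℕ) (κ : ℕ → ℕ → ℕ) : Prop :=
  ∀ j n d, N j ≤ n → h (κ j n) (v n) * (j + 1) ≤ (p j + 2) * 2 ^ κ j n ∧
    p j * 2 ^ d ≤ h d (v n) * (j + 1) + 2 ^ d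

theorem Settles.relMeasure_mem {A : Set Cantor} (hA : IsClosed A) {v : ℕ → List Bool} {p N : ℕ → ℕ}
    {κ : ℕ → ℕ → ℕ} (h : Settles (count A) v p N κ) {j n : ℕ} (hn : N j ≤ n) :
    ((p j : ℝ) - 1) / (j + 1) ≤ relMeasure A (v n) ∧
      relMeasure A (v n) ≤ (p j + 2) / (j + 1) := by
  have hj : (0 : ℝ) < j + 1 := by positivity
  constructor
  · refine ge_of_tendsto' (tendsto_count hA (v n)) fun d => ?_
    have h1 : (p j : ℝ) * 2 ^ d ≤ count A d (v n) * (j + 1) + 2 ^ d := by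
      exact_mod_cast (h j n d hn).2
    rw [div_le_div_iff₀ hj (by positivity)]
    linarith
  · refine (relMeasure_le_count A (κ j n) (v n)).trans ?_
    have h1 : (count A (κ j n) (v n) : ℝ) * (j + 1) ≤ (p j + 2) * 2 ^ κ j n := by
      exact_mod_cast (h j n 0 hn).1
    rwa [div_le_div_iff₀ (by positivity) hj]

theorem Settles.hasDensity {A : Set Cantor} (hA : IsClosed A) {z : Cantor} {p N : ℕ → ℕ}
    {κ : ℕ → ℕ → ℕ} {r : ℝ} (h : Settles (count A) (PiNat.res z) p N κ)
    (hr : ∀ j : ℕ, (p j : ℝ) - 1 ≤ r * (j + 1) ∧ r * (j + 1) ≤ p j + 2) : HasDensity A z r := by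
  rw [hasDensity_iff, Metric.tendsto_atTop]
  intro ε hε
  obtain ⟨j, hj⟩ := exists_nat_one_div_lt (div_pos hε three_pos)
  have hj1 : (0 : ℝ) < j + 1 := by positivity
  rw [div_lt_iff₀ hj1] at hj
  refine ⟨N j, fun n hn => ?_⟩
  obtain ⟨h1, h2⟩ := h.relMeasure_mem hA hn
  rw [div_le_iff₀ hj1] at h1
  rw [le_div_iff₀ hj1] at h2
  obtain ⟨h3, h4⟩ := hr j
  rw [Real.dist_eq, abs_lt]
  constructor
  · refine lt_of_mul_lt_mul_right (a := (j : ℝ) + 1) ?_ hj1.le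
    linarith
  · refine lt_of_mul_lt_mul_right (a := (j : ℝ) + 1) ?_ hj1.le
    linarith

theorem Settles.exists_hasDensity {A : Set Cantor} (hA : IsClosed A) {z : Cantor} {p N : ℕ → ℕ}
    {κ : ℕ → ℕ → ℕ} (h : Settles (count A) (PiNat.res z) p N κ) :
    ∃ r, HasDensity A z r ∧ ∀ j : ℕ, (p j : ℝ) - 1 ≤ r * (j + 1) ∧ r * (j + 1) ≤ p j + 2 := by
  have hc : CauchySeq fun n => relMeasure A (PiNat.res z n) := by
    refine Metric.cauchySeq_iff'.2 fun ε hε => ?_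
    obtain ⟨j, hj⟩ := exists_nat_one_div_lt (div_pos hε (by norm_num : (0 : ℝ) < 4))
    have hj1 : (0 : ℝ) < j + 1 := by positivity
    rw [div_lt_iff₀ hj1] at hj
    refine ⟨N j, fun n hn => ?_⟩
    obtain ⟨h1, h2⟩ := h.relMeasure_mem hA hn
    obtain ⟨h3, h4⟩ := h.relMeasure_mem hA (le_refl (N j))
    rw [div_le_iff₀ hj1] at h1 h3
    rw [le_div_iff₀ hj1] at h2 h4
    rw [Real.dist_eq, abs_lt]
    constructor
    · refine lt_of_mul_lt_mul_right (a := (j : ℝ) + 1) ?_ hj1.le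
      linarith
    · refine lt_of_mul_lt_mul_right (a := (j : ℝ) + 1) ?_ hj1.le
      linarith
  obtain ⟨r, hr⟩ := cauchySeq_tendsto_of_complete hc
  refine ⟨r, hasDensity_iff.2 hr, fun j => ?_⟩
  have hj1 : (0 : ℝ) < j + 1 := by positivity
  rw [← div_le_iff₀ hj1, ← le_div_iff₀ hj1]
  exact ⟨ge_of_tendsto hr (eventually_atTop.2 ⟨N j, fun n hn => (h.relMeasure_mem hA hn).1⟩),
    le_of_tendsto hr (eventually_atTop.2 ⟨N j, fun n hn => (h.relMeasure_mem hA hn).2⟩)⟩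

theorem exists_settles {A : Set Cantor} (hA : IsClosed A) {z : Cantor} {p : ℕ → ℕ} {r : ℝ}
    (h : HasDensity A z r) (hr : ∀ j : ℕ, p j ≤ r * (j + 1) ∧ r * (j + 1) ≤ p j + 1) :
    ∃ N κ, Settles (count A) (PiNat.res z) p N κ := by
  rw [hasDensity_iff, Metric.tendsto_atTop] at h
  have hN : ∀ j : ℕ, ∃ N, ∀ n ≥ N, relMeasure A (PiNat.res z n) < (p j + 2) / (j + 1) ∧
      (p j - 1) / (j + 1) ≤ relMeasure A (PiNat.res z n) := by
    intro j
    have hj1 : (0 : ℝ) < j + 1 := by positivity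
    obtain ⟨N, hN⟩ := h (1 / (j + 1)) (by positivity)
    refine ⟨N, fun n hn => ?_⟩
    have h1 := abs_lt.1 (Real.dist_eq _ _ ▸ hN n hn)
    rw [← neg_div, div_lt_iff₀ hj1, lt_div_iff₀ hj1] at h1
    obtain ⟨h3, h4⟩ := hr j
    rw [lt_div_iff₀ hj1, div_le_iff₀ hj1]
    constructor <;> linarith [h1.1, h1.2]
  choose N hN using hN
  have hκ : ∀ j n, ∃ d, N j ≤ n →
      (count A d (PiNat.res z n) : ℝ) / 2 ^ d < (p j + 2) / (j + 1) := by
    intro j n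
    by_cases hn : N j ≤ n
    · obtain ⟨d, hd⟩ := exists_count_lt hA _ (hN j n hn).1
      exact ⟨d, fun _ => hd⟩
    · exact ⟨0, fun hn' => absurd hn' hn⟩
  choose κ hκ using hκ
  refine ⟨N, κ, fun j n d hn => ⟨?_, ?_⟩⟩
  · have := (hκ j n hn).le
    rw [div_le_div_iff₀ (by positivity) (by positivity)] at this
    exact_mod_cast this
  · have := (hN j n hn).2.trans (relMeasure_le_count A d _)
    rw [div_le_div_iff₀ (by positivity) (by positivity)] at this
    have h2 : (p j : ℝ) * 2 ^ d ≤ count A d (PiNat.res z n) * (j + 1) + 2 ^ d := by linarith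
    exact_mod_cast h2

theorem exists_approx {r : ℝ} (hr : 0 ≤ r) :
    ∃ p : ℕ → ℕ, ∀ j : ℕ, p j ≤ r * (j + 1) ∧ r * (j + 1) ≤ p j + 1 :=
  ⟨fun j => ⌊r * (j + 1)⌋₊, fun _ => ⟨Nat.floor_le (by positivity), (Nat.lt_floor_add_one _).le⟩⟩

/-- Failure of the density at a point to exist as a condition on the counts along the words `v n`:
for some `e`, there are arbitrarily large `n₁ N` and `n₂ N` for which the relative measures differ
by at least `1 / (e + 1)`, the smaller one being bounded by the counts at depth `κ N`. -/
def Oscillates (h : ℕ → List Bool → ℕ) (v : ℕ → List Bool) (e : ℕ) (n₁ n₂ κ : ℕ → ℕ) : Prop :=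
  ∀ N d, N ≤ n₁ N ∧ N ≤ n₂ N ∧
    h (κ N) (v (n₂ N)) * (e + 1) * 2 ^ d + 2 ^ d * 2 ^ κ N ≤ h d (v (n₁ N)) * (e + 1) * 2 ^ κ N

theorem Oscillates.blurry {A : Set Cantor} (hA : IsClosed A) {z : Cantor} {e : ℕ}
    {n₁ n₂ κ : ℕ → ℕ} (h : Oscillates (count A) (PiNat.res z) e n₁ n₂ κ) : Blurry A z := by
  rintro ⟨r, hr⟩
  have he : (0 : ℝ) < e + 1 := by positivity
  have hgap : ∀ N, relMeasure A (PiNat.res z (n₂ N)) + 1 / (e + 1) ≤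
      relMeasure A (PiNat.res z (n₁ N)) := by
    intro N
    refine ge_of_tendsto' (tendsto_count hA _) fun d => ?_
    refine (add_le_add_left (relMeasure_le_count A (κ N) _) _).trans ?_
    have h1 : (count A (κ N) (PiNat.res z (n₂ N)) : ℝ) * (e + 1) * 2 ^ d + 2 ^ d * 2 ^ κ N ≤
        count A d (PiNat.res z (n₁ N)) * (e + 1) * 2 ^ κ N := by
      exact_mod_cast (h N d).2.2
    rw [div_add_div _ _ (by positivity) he.ne', div_le_div_iff₀ (by positivity) (by positivity)]
    linarith
  rw [hasDensity_iff, Metric.tendsto_atTop] at hr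
  obtain ⟨N, hN⟩ := hr (1 / (e + 1) / 2) (by positivity)
  have h1 := abs_lt.1 (Real.dist_eq _ _ ▸ hN _ (h N 0).1)
  have h2 := abs_lt.1 (Real.dist_eq _ _ ▸ hN _ (h N 0).2.1)
  linarith [hgap N, h1.1, h1.2, h2.1, h2.2]

theorem exists_oscillates {A : Set Cantor} (hA : IsClosed A) {z : Cantor} (h : Blurry A z) :
    ∃ e n₁ n₂ κ, Oscillates (count A) (PiNat.res z) e n₁ n₂ κ := by
  -- a sequence of relative measures without a limit is not a Cauchy sequence
  have hc : ¬ CauchySeq fun n => relMeasure A (PiNat.res z n) := fun hc => by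
    obtain ⟨r, hr⟩ := cauchySeq_tendsto_of_complete hc
    exact h ⟨r, hasDensity_iff.2 hr⟩
  rw [Metric.cauchySeq_iff] at hc
  push Not at hc
  obtain ⟨ε, hε, hc⟩ := hc
  obtain ⟨e, he⟩ := exists_nat_one_div_lt hε
  have he1 : (0 : ℝ) < e + 1 := by positivity
  have hsel : ∀ N, ∃ n₁ n₂ κ, N ≤ n₁ ∧ N ≤ n₂ ∧
      (count A κ (PiNat.res z n₂) : ℝ) / 2 ^ κ + 1 / (e + 1) ≤ relMeasure A (PiNat.res z n₁) := by
    intro N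
    obtain ⟨m, hm, n, hn, hmn⟩ := hc N
    rw [Real.dist_eq] at hmn
    rcases le_total (relMeasure A (PiNat.res z m)) (relMeasure A (PiNat.res z n)) with hle | hle
    · rw [abs_of_nonpos (by linarith)] at hmn
      obtain ⟨κ, hκ⟩ := exists_count_lt hA (PiNat.res z m)
        (c := relMeasure A (PiNat.res z n) - 1 / (e + 1)) (by linarith)
      exact ⟨n, m, κ, hn, hm, by linarith⟩
    · rw [abs_of_nonneg (by linarith)] at hmn
      obtain ⟨κ, hκ⟩ := exists_count_lt hA (PiNat.res z n)
        (c := relMeasure A (PiNat.res z m) - 1 / (e + 1)) (by linarith)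
      exact ⟨m, n, κ, hm, hn, by linarith⟩
  choose n₁ n₂ κ h1 h2 h3 using hsel
  refine ⟨e, n₁, n₂, κ, fun N d => ⟨h1 N, h2 N, ?_⟩⟩
  have := (h3 N).trans (relMeasure_le_count A d _)
  rw [div_add_div _ _ (by positivity) he1.ne', div_le_div_iff₀ (by positivity) (by positivity)]
    at this
  have h4 : (count A (κ N) (PiNat.res z (n₂ N)) : ℝ) * (e + 1) * 2 ^ d + 2 ^ d * 2 ^ κ N ≤
      count A d (PiNat.res z (n₁ N)) * (e + 1) * 2 ^ κ N := by linarith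
  exact_mod_cast h4

/-! ### Lightface definability of `𝒰` and of the solid and injective compact sets -/

/-- The function coded by the entries of `y` with first index `t`. -/
def oFun (t : ℕ) (y : Baire) (n : ℕ) : ℕ :=
  y (Nat.pair t n)

/-- The sequence of words coded by the entries of `y` with first index `t`. -/
def oWord (t : ℕ) (y : Baire) (n : ℕ) : List Bool :=
  (Encodable.decode (oFun t y n)).getD []

/-- The function of two arguments coded by the entries of `y` with first index `t`. -/
def oFun₂ (t : ℕ) (y : Baire) (m n : ℕ) : ℕ :=
  oFun t y (Nat.pair m n)

/-- The counts of cylinders coded by the entries of `y` with first index `0`. -/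
def oCount (y : Baire) (d : ℕ) (u : List Bool) : ℕ :=
  oFun 0 y (Encodable.encode (u, d))

/-- The recursive law of the counts of cylinders. -/
def IsCount (h : ℕ → List Bool → ℕ) : Prop :=
  ∀ p : List Bool × ℕ, h 0 p.1 ≤ 1 ∧ h (p.2 + 1) p.1 = h p.2 (false :: p.1) + h p.2 (true :: p.1)

/-- The words `v n` are the initial segments of a point of the Cantor space. -/
def IsBranch (v : ℕ → List Bool) : Prop :=
  ∀ n, v 0 = [] ∧ (v (n + 1) = false :: v n ∨ v (n + 1) = true :: v n)

theorem isCount_count (A : Set Cantor) : IsCount (count A) := by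
  refine fun p => ⟨?_, rfl⟩
  rw [count]
  split_ifs <;> simp

theorem oCount_eq_count {y : Baire} {A : Set Cantor} (hA : CodesSet y A) (hy : IsCount (oCount y)) :
    oCount y = count A := by
  funext d
  induction d with
  | zero =>
    funext u
    have h1 := hA u
    have h2 := (hy (u, 0)).1
    by_cases h : (A ∩ cyl u).Nonempty
    · have : oCount y 0 u ≠ 0 := h1.2 h
      simp only [count, h, if_true]
      simp only at h2
      omega
    · have : oCount y 0 u = 0 := not_not.1 (mt h1.1 h)
      simp [count, h, this]
  | succ d ih =>
    funext u
    rw [(hy (u, d)).2, ih]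
    rfl

theorem codesSet_of_oCount_eq {y : Baire} {A : Set Cantor} (h : oCount y = count A) :
    CodesSet y A := by
  intro u
  have : y (Nat.pair 0 (Encodable.encode (u, 0))) = count A 0 u := congrFun (congrFun h 0) u
  rw [this, count]
  split_ifs with hA <;> simp [hA]

theorem isBranch_res (z : Cantor) : IsBranch (PiNat.res z) := by
  refine fun n => ⟨rfl, ?_⟩
  rw [PiNat.res_succ]
  cases z n <;> simp

theorem IsBranch.exists_eq_res {v : ℕ → List Bool} (hv : IsBranch v) : ∃ z, v = PiNat.res z := by
  have h : ∀ n, ∃ b, v (n + 1) = b :: v n := fun n => (hv n).2.elim (⟨_, ·⟩) (⟨_, ·⟩)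
  choose z hz using h
  refine ⟨z, funext fun n => ?_⟩
  induction n with
  | zero => exact (hv 0).1
  | succ n ih => rw [hz, ih, PiNat.res_succ]

section Recursive

variable {α : Type} [Primcodable α]

theorem RecFun.oFun {F : Baire → α → ℕ} (t : ℕ) (hF : RecFun F) :
    RecFun fun y a => oFun t y (F y a) :=
  (RecFun.comp (Primrec₂.natPair.comp (Primrec.const t) Primrec.id) hF).oracle

theorem RecFun.oWord {F : Baire → α → ℕ} (t : ℕ) (hF : RecFun F) :
    RecFun fun y a => oWord t y (F y a) :=
  RecFun.comp (Primrec.option_getD.comp Primrec.decode (Primrec.const [])) (hF.oFun t)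

theorem RecFun.oFun₂ {F G : Baire → α → ℕ} (t : ℕ) (hF : RecFun F) (hG : RecFun G) :
    RecFun fun y a => oFun₂ t y (F y a) (G y a) :=
  (RecFun.comp₂ Primrec₂.natPair hF hG).oFun t

theorem RecFun.oCount {D : Baire → α → ℕ} {U : Baire → α → List Bool} (hD : RecFun D)
    (hU : RecFun U) : RecFun fun y a => oCount y (D y a) (U y a) :=
  (RecFun.comp₂ (f := fun d u => Encodable.encode (u, d))
    (Primrec.encode.comp (Primrec.pair Primrec.snd Primrec.fst)) hD hU).oFun 0

theorem RecFun.add {F G : Baire → α → ℕ} (hF : RecFun F) (hG : RecFun G) :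
    RecFun fun y a => F y a + G y a :=
  RecFun.comp₂ Primrec.nat_add hF hG

theorem RecFun.mul {F G : Baire → α → ℕ} (hF : RecFun F) (hG : RecFun G) :
    RecFun fun y a => F y a * G y a :=
  RecFun.comp₂ Primrec.nat_mul hF hG

theorem RecFun.const {β : Type} [Primcodable β] (b : β) : RecFun fun (_ : Baire) (_ : α) => b :=
  RecFun.of_primrec (Primrec.const b)

theorem RecFun.two_pow {F : Baire → α → ℕ} (hF : RecFun F) : RecFun fun y a => 2 ^ F y a :=
  RecFun.comp₂ (Primrec₂.unpaired'.1 Nat.Primrec.pow) (RecFun.const 2) hF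

theorem RecFun.cons {F : Baire → α → List Bool} (b : Bool) (hF : RecFun F) :
    RecFun fun y a => b :: F y a :=
  RecFun.comp₂ Primrec.list_cons (RecFun.const b) hF

theorem RecPred.le {F G : Baire → α → ℕ} (hF : RecFun F) (hG : RecFun G) :
    RecPred fun y a => F y a ≤ G y a :=
  RecPred.of_primrecRel Primrec.nat_le hF hG

theorem RecPred.eq {β : Type} [Primcodable β] [DecidableEq β] {F G : Baire → α → β} (hF : RecFun F)
    (hG : RecFun G) : RecPred fun y a => F y a = G y a :=
  RecPred.of_primrecRel Primrec.eq hF hG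

end Recursive

theorem isPi01_isCount : IsPi01 fun y => IsCount (oCount y) := by
  have hu : RecFun fun (_ : Baire) (p : List Bool × ℕ) => p.1 := RecFun.of_primrec Primrec.fst
  have hd : RecFun fun (_ : Baire) (p : List Bool × ℕ) => p.2 := RecFun.of_primrec Primrec.snd
  exact ((RecPred.le (RecFun.oCount (RecFun.const 0) hu) (RecFun.const 1)).and
    (RecPred.eq (RecFun.oCount (hd.add (RecFun.const 1)) hu)
      ((RecFun.oCount hd (hu.cons false)).add (RecFun.oCount hd (hu.cons true))))).isPi01

theorem isPi01_isBranch (t : ℕ) : IsPi01 fun y => IsBranch (oWord t y) := by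
  have hn : RecFun fun (_ : Baire) (n : ℕ) => n := RecFun.of_primrec Primrec.id
  have hs := (hn.add (RecFun.const 1)).oWord t
  exact ((RecPred.eq ((RecFun.const 0).oWord t) (RecFun.const [])).and
    ((RecPred.eq hs ((hn.oWord t).cons false)).or
      (RecPred.eq hs ((hn.oWord t).cons true)))).isPi01

theorem isPi01_settles (t₁ t₂ t₃ t₄ : ℕ) :
    IsPi01 fun y => Settles (oCount y) (oWord t₁ y) (oFun t₂ y) (oFun t₃ y) (oFun₂ t₄ y) := by
  have hj : RecFun fun (_ : Baire) (p : ℕ × ℕ × ℕ) => p.1 := RecFun.of_primrec Primrec.fst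
  have hn : RecFun fun (_ : Baire) (p : ℕ × ℕ × ℕ) => p.2.1 :=
    RecFun.of_primrec (Primrec.fst.comp Primrec.snd)
  have hd : RecFun fun (_ : Baire) (p : ℕ × ℕ × ℕ) => p.2.2 :=
    RecFun.of_primrec (Primrec.snd.comp Primrec.snd)
  have hκ := RecFun.oFun₂ t₄ hj hn
  have hv := hn.oWord t₁
  have hp := hj.oFun t₂
  have hj1 := hj.add (RecFun.const 1)
  have := ((RecPred.le (hj.oFun t₃) hn).imp
    ((RecPred.le ((RecFun.oCount hκ hv).mul hj1) ((hp.add (RecFun.const 2)).mul hκ.two_pow)).and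
      (RecPred.le (hp.mul hd.two_pow)
        (((RecFun.oCount hd hv).mul hj1).add hd.two_pow)))).isPi01
  simpa only [Prod.forall, Settles] using this

theorem isPi01_oscillates (t₁ t₂ t₃ t₄ t₅ : ℕ) :
    IsPi01 fun y => Oscillates (oCount y) (oWord t₁ y) (oFun t₂ y 0) (oFun t₃ y) (oFun t₄ y)
      (oFun t₅ y) := by
  have hN : RecFun fun (_ : Baire) (p : ℕ × ℕ) => p.1 := RecFun.of_primrec Primrec.fst
  have hd : RecFun fun (_ : Baire) (p : ℕ × ℕ) => p.2 := RecFun.of_primrec Primrec.snd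
  have h1 := hN.oFun t₃
  have h2 := hN.oFun t₄
  have hκ := hN.oFun t₅
  have he := ((RecFun.const (α := ℕ × ℕ) 0).oFun t₂).add (RecFun.const 1)
  have := ((RecPred.le hN h1).and ((RecPred.le hN h2).and (RecPred.le
    ((((RecFun.oCount hκ (h2.oWord t₁)).mul he).mul hd.two_pow).add (hd.two_pow.mul hκ.two_pow))
    (((RecFun.oCount hd (h1.oWord t₁)).mul he).mul hκ.two_pow)))).isPi01
  simpa only [Prod.forall, Oscillates] using this

/-- The oracle with the given functions as its rows. -/
def assemble (l : List (ℕ → ℕ)) : Baire :=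
  fun m => l.getD m.unpair.1 (fun _ => 0) m.unpair.2

theorem oFun_assemble (l : List (ℕ → ℕ)) (t : ℕ) :
    oFun t (assemble l) = l.getD t fun _ => 0 := by
  funext n
  simp [oFun, assemble]

/-- The row of an oracle that codes the counts of cylinders. -/
noncomputable def countRow (A : Set Cantor) (m : ℕ) : ℕ :=
  ((Encodable.decode (α := List Bool × ℕ) m).map fun p => count A p.2 p.1).getD 0

theorem oCount_assemble (A : Set Cantor) (l : List (ℕ → ℕ)) :
    oCount (assemble (countRow A :: l)) = count A := by
  funext d u
  simp [oCount, oFun_assemble, countRow]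

theorem oWord_eq_res {t : ℕ} {y : Baire} {z : Cantor}
    (h : oFun t y = fun n => Encodable.encode (PiNat.res z n)) : oWord t y = PiNat.res z := by
  funext n
  simp [oWord, h]

theorem oFun₂_eq {t : ℕ} {y : Baire} {κ : ℕ → ℕ → ℕ}
    (h : oFun t y = fun m => κ m.unpair.1 m.unpair.2) : oFun₂ t y = κ := by
  funext m n
  simp [oFun₂, h]

theorem CodesReal.bounds {y : Baire} {r : ℝ} (h : CodesReal y r) (j : ℕ) :
    (oFun 1 y j : ℝ) - 1 ≤ r * (j + 1) ∧ r * (j + 1) ≤ oFun 1 y j + 2 := by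
  have := h j
  unfold oFun
  constructor <;> linarith [this.1, this.2]

/-- The oracle contains a point at which the density exists and is the coded real. -/
def CodesDensity (y : Baire) : Prop :=
  IsCount (oCount y) ∧ IsBranch (oWord 2 y) ∧
    Settles (oCount y) (oWord 2 y) (oFun 1 y) (oFun 3 y) (oFun₂ 4 y)

/-- The oracle contains a blurry point. -/
def CodesBlurry (y : Baire) : Prop :=
  IsCount (oCount y) ∧ IsBranch (oWord 2 y) ∧
    Oscillates (oCount y) (oWord 2 y) (oFun 3 y 0) (oFun 4 y) (oFun 5 y) (oFun 6 y)

/-- The oracle contains two distinct points at which the density is the same real in `(0, 1)`. -/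
def CodesRepetition (y : Baire) : Prop :=
  IsCount (oCount y) ∧ (IsBranch (oWord 2 y) ∧ IsBranch (oWord 5 y)) ∧
    (Settles (oCount y) (oWord 2 y) (oFun 8 y) (oFun 3 y) (oFun₂ 4 y) ∧
      Settles (oCount y) (oWord 5 y) (oFun 8 y) (oFun 6 y) (oFun₂ 7 y)) ∧
    ∀ _ : Unit, oWord 2 y (oFun 9 y 0) ≠ oWord 5 y (oFun 9 y 0) ∧
      2 ≤ oFun 8 y (oFun 9 y 1) ∧ oFun 8 y (oFun 9 y 1) + 2 ≤ oFun 9 y 1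

theorem isPi01_codesDensity : IsPi01 CodesDensity :=
  isPi01_isCount.and ((isPi01_isBranch 2).and (isPi01_settles 2 1 3 4))

theorem isPi01_codesBlurry : IsPi01 CodesBlurry :=
  isPi01_isCount.and ((isPi01_isBranch 2).and (isPi01_oscillates 2 3 4 5 6))

theorem isPi01_codesRepetition : IsPi01 CodesRepetition := by
  refine isPi01_isCount.and (((isPi01_isBranch 2).and (isPi01_isBranch 5)).and
    (((isPi01_settles 2 8 3 4).and (isPi01_settles 5 8 6 7)).and ?_))
  have h0 := (RecFun.const (α := Unit) 0).oFun 9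
  have h1 := (RecFun.const (α := Unit) 1).oFun 9
  exact (((RecPred.eq (h0.oWord 2) (h0.oWord 5)).not).and
    ((RecPred.le (RecFun.const 2) (h1.oFun 8)).and
      (RecPred.le ((h1.oFun 8).add (RecFun.const 2)) h1))).isPi01

theorem isClosed_coe (K : Hyperspace) : IsClosed (K : Set Cantor) :=
  K.isCompact.isClosed

theorem mem_𝒰_iff {p : Hyperspace × UnitOpen} :
    p ∈ 𝒰 ↔ ∃ y, CodesSet y p.1 ∧ CodesReal y p.2 ∧ CodesDensity y := by
  obtain ⟨K, r⟩ := p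
  constructor
  · rintro ⟨z, hz⟩
    obtain ⟨p, hp⟩ := exists_approx r.2.1.le
    obtain ⟨N, κ, h⟩ := exists_settles (isClosed_coe K) hz hp
    set y := assemble [countRow K, p, fun n => Encodable.encode (PiNat.res z n), N,
      fun m => κ m.unpair.1 m.unpair.2] with hy
    have h0 : oCount y = count K := oCount_assemble _ _
    have h1 : oFun 1 y = p := oFun_assemble _ _
    have h2 : oWord 2 y = PiNat.res z := oWord_eq_res (oFun_assemble _ _)
    have h3 : oFun 3 y = N := oFun_assemble _ _
    have h4 : oFun₂ 4 y = κ := oFun₂_eq (oFun_assemble _ _)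
    refine ⟨y, codesSet_of_oCount_eq h0, fun j => ?_, ?_, ?_, ?_⟩
    · rw [show y (Nat.pair 1 j) = p j from congrFun h1 j]
      exact hp j
    · rw [h0]
      exact isCount_count _
    · rw [h2]
      exact isBranch_res z
    · rw [h0, h1, h2, h3, h4]
      exact h
  · rintro ⟨y, hK, hr, hc, hb, h⟩
    obtain ⟨z, hz⟩ := hb.exists_eq_res
    rw [oCount_eq_count hK hc, hz] at h
    exact ⟨z, h.hasDensity (isClosed_coe K) hr.bounds⟩

theorem notMem_Sld_iff {K : Hyperspace} (r : UnitOpen) :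
    K ∉ Sld ↔ ∃ y, CodesSet y K ∧ CodesReal y r ∧ CodesBlurry y := by
  constructor
  · intro hK
    simp only [Sld, mem_ofPred_eq, not_forall, not_not] at hK
    obtain ⟨z, hz⟩ := hK
    obtain ⟨p, hp⟩ := exists_approx r.2.1.le
    obtain ⟨e, n₁, n₂, κ, h⟩ := exists_oscillates (isClosed_coe K) hz
    set y := assemble [countRow K, p, fun n => Encodable.encode (PiNat.res z n), fun _ => e,
      n₁, n₂, κ] with hy
    have h0 : oCount y = count K := oCount_assemble _ _
    have h1 : oFun 1 y = p := oFun_assemble _ _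
    have h2 : oWord 2 y = PiNat.res z := oWord_eq_res (oFun_assemble _ _)
    have h3 : oFun 3 y = fun _ => e := oFun_assemble _ _
    have h4 : oFun 4 y = n₁ := oFun_assemble _ _
    have h5 : oFun 5 y = n₂ := oFun_assemble _ _
    have h6 : oFun 6 y = κ := oFun_assemble _ _
    refine ⟨y, codesSet_of_oCount_eq h0, fun j => ?_, ?_, ?_, ?_⟩
    · rw [show y (Nat.pair 1 j) = p j from congrFun h1 j]
      exact hp j
    · rw [h0]
      exact isCount_count _
    · rw [h2]
      exact isBranch_res z
    · rw [h0, h2, h3, h4, h5, h6]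
      exact h
  · rintro ⟨y, hK, -, hc, hb, h⟩ hS
    obtain ⟨z, hz⟩ := hb.exists_eq_res
    rw [oCount_eq_count hK hc, hz] at h
    exact hS z (h.blurry (isClosed_coe K))

theorem notMem_RngInj_iff {K : Hyperspace} (r : UnitOpen) :
    K ∉ RngInj ↔ ∃ y, CodesSet y K ∧ CodesReal y r ∧ CodesRepetition y := by
  constructor
  · intro hK
    simp only [RngInj, mem_ofPred_eq, not_forall] at hK
    obtain ⟨z₁, z₂, s, hs, hz₁, hz₂, hne⟩ := hK
    obtain ⟨p, hp⟩ := exists_approx r.2.1.le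
    obtain ⟨q, hq⟩ := exists_approx hs.1.le
    obtain ⟨N₁, κ₁, hset₁⟩ := exists_settles (isClosed_coe K) hz₁ hq
    obtain ⟨N₂, κ₂, hset₂⟩ := exists_settles (isClosed_coe K) hz₂ hq
    -- a denominator for which the approximation `q` keeps its distance from `0` and `1`
    obtain ⟨e, he⟩ := exists_nat_gt (max (3 / s) (3 / (1 - s)))
    have he0 := (le_max_left _ _).trans_lt he
    have he1 := (le_max_right _ _).trans_lt he
    rw [div_lt_iff₀ hs.1] at he0
    rw [div_lt_iff₀ (sub_pos.2 hs.2)] at he1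
    have hqe := hq e
    have hs0 := hs.1
    have hs1 := hs.2
    have hqe2 : 2 ≤ q e := by
      have : (2 : ℝ) ≤ q e := by linarith [hqe.2]
      exact_mod_cast this
    have hqe3 : q e + 2 ≤ e := by
      have : (q e : ℝ) + 2 ≤ e := by linarith [hqe.1]
      exact_mod_cast this
    have hres : PiNat.res z₁ (PiNat.firstDiff z₁ z₂ + 1) ≠
        PiNat.res z₂ (PiNat.firstDiff z₁ z₂ + 1) := fun h =>
      PiNat.apply_firstDiff_ne hne (PiNat.res_eq_res.1 h (Nat.lt_succ_self _))
    set y := assemble [countRow K, p, fun n => Encodable.encode (PiNat.res z₁ n), N₁,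
      fun m => κ₁ m.unpair.1 m.unpair.2, fun n => Encodable.encode (PiNat.res z₂ n), N₂,
      fun m => κ₂ m.unpair.1 m.unpair.2, q,
      fun i => if i = 0 then PiNat.firstDiff z₁ z₂ + 1 else e] with hy
    have h0 : oCount y = count K := oCount_assemble _ _
    have h1 : oFun 1 y = p := oFun_assemble _ _
    have h2 : oWord 2 y = PiNat.res z₁ := oWord_eq_res (oFun_assemble _ _)
    have h3 : oFun 3 y = N₁ := oFun_assemble _ _
    have h4 : oFun₂ 4 y = κ₁ := oFun₂_eq (oFun_assemble _ _)
    have h5 : oWord 5 y = PiNat.res z₂ := oWord_eq_res (oFun_assemble _ _)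
    have h6 : oFun 6 y = N₂ := oFun_assemble _ _
    have h7 : oFun₂ 7 y = κ₂ := oFun₂_eq (oFun_assemble _ _)
    have h8 : oFun 8 y = q := oFun_assemble _ _
    have h9 : oFun 9 y = fun i => if i = 0 then PiNat.firstDiff z₁ z₂ + 1 else e :=
      oFun_assemble _ _
    refine ⟨y, codesSet_of_oCount_eq h0, fun j => ?_, ?_, ⟨?_, ?_⟩, ⟨?_, ?_⟩, fun _ => ?_⟩
    · rw [show y (Nat.pair 1 j) = p j from congrFun h1 j]
      exact hp j
    · rw [h0]
      exact isCount_count _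
    · rw [h2]
      exact isBranch_res z₁
    · rw [h5]
      exact isBranch_res z₂
    · rw [h0, h2, h3, h4, h8]
      exact hset₁
    · rw [h0, h5, h6, h7, h8]
      exact hset₂
    · rw [h2, h5, h8, h9]
      exact ⟨hres, hqe2, hqe3⟩
  · rintro ⟨y, hK, -, hc, ⟨hb₁, hb₂⟩, ⟨hset₁, hset₂⟩, h⟩ hR
    obtain ⟨hne, hp2, hp3⟩ := h ()
    obtain ⟨z₁, hz₁⟩ := hb₁.exists_eq_res
    obtain ⟨z₂, hz₂⟩ := hb₂.exists_eq_res
    rw [oCount_eq_count hK hc, hz₁] at hset₁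
    rw [oCount_eq_count hK hc, hz₂] at hset₂
    rw [hz₁, hz₂] at hne
    obtain ⟨s, hs₁, hs⟩ := hset₁.exists_hasDensity (isClosed_coe K)
    have hs₂ := hset₂.hasDensity (isClosed_coe K) hs
    obtain ⟨hl, hu⟩ := hs (oFun 9 y 1)
    have hp2' : (2 : ℝ) ≤ oFun 8 y (oFun 9 y 1) := by exact_mod_cast hp2
    have hp3' : (oFun 8 y (oFun 9 y 1) : ℝ) + 2 ≤ oFun 9 y 1 := by exact_mod_cast hp3
    have he : (0 : ℝ) < oFun 9 y 1 + 1 := by positivity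
    have hs01 : s ∈ Ioo (0 : ℝ) 1 := by
      constructor
      · exact pos_of_mul_pos_left (by linarith) he.le
      · exact lt_of_mul_lt_mul_right (a := (oFun 9 y 1 : ℝ) + 1) (by linarith) he.le
    exact hne (by rw [hR z₁ z₂ s hs01 hs₁ hs₂])

theorem lightSigma11_𝒰 : LightSigma11 𝒰 := by
  have h := lightSigma11_of_isPi01 isPi01_codesDensity
  convert h using 1
  ext p
  exact mem_𝒰_iff

theorem lightPi11_compl_𝒰_inter :
    LightPi11 (𝒰ᶜ ∩ (Sld ∩ RngInj) ×ˢ (univ : Set UnitOpen)) := by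
  have h := lightSigma11_of_isPi01
    (isPi01_codesDensity.or (isPi01_codesBlurry.or isPi01_codesRepetition))
  rw [LightPi11]
  convert h using 1
  ext p
  have h1 : p ∈ (𝒰ᶜ ∩ (Sld ∩ RngInj) ×ˢ (univ : Set UnitOpen))ᶜ ↔
      p ∈ 𝒰 ∨ p.1 ∉ Sld ∨ p.1 ∉ RngInj := by
    simp only [mem_compl_iff, mem_inter_iff, mem_prod, mem_univ, and_true]
    tauto
  rw [h1, mem_𝒰_iff, notMem_Sld_iff p.2, notMem_RngInj_iff p.2, ← exists_or, ← exists_or]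
  refine exists_congr fun y => ?_
  tauto

end DensityUniversal

open DensityUniversal in
theorem mainTheorem2 :
    -- (a)
    (LightSigma11 𝒰 ∧ IsUniversalFor AnalyticSet 𝒰 ∧
      LightPi11 𝒰ᶜ ∧ IsUniversalFor Coanalytic 𝒰ᶜ) ∧
    -- (b)
    (Parametrizes 𝒰 Sld {S : Set UnitOpen | AnalyticSet S} ∧
      Parametrizes 𝒰ᶜ Sld {S : Set UnitOpen | Coanalytic S}) ∧
    -- (c)
    (Parametrizes 𝒰 (Sld ∩ RngInj) {S : Set UnitOpen | BoldDelta11 S} ∧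
      LightPi11 (𝒰ᶜ ∩ (Sld ∩ RngInj) ×ˢ Set.univ) ∧
      Parametrizes 𝒰ᶜ (Sld ∩ RngInj) {S : Set UnitOpen | BoldDelta11 S}) ∧
    -- the boldface Δ¹₁ subsets of (0, 1) are exactly its Borel subsets
    (∀ S : Set UnitOpen, BoldDelta11 S ↔ MeasurableSet S) := by
  have hA : AnalyticSet 𝒰 := lightSigma11_𝒰.analyticSet
  have hsec : ∀ K, AnalyticSet (vsection 𝒰 K) := analyticSet_vsection hA
  have hcosec : ∀ K, Coanalytic (vsection 𝒰ᶜ K) := fun K => by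
    rw [vsection_compl, Coanalytic, compl_compl]
    exact hsec K
  have hex : ∀ S : Set UnitOpen, Coanalytic S → ∃ K ∈ Sld, vsection 𝒰ᶜ K = S := by
    intro S hS
    obtain ⟨K, hK, h⟩ := exists_solid_of_analyticSet hS
    exact ⟨K, hK, by rw [vsection_compl, h, compl_compl]⟩
  refine ⟨⟨lightSigma11_𝒰, ⟨hA, ?_⟩, ?_, ⟨?_, ?_⟩⟩, ⟨?_, ?_⟩, ⟨?_, lightPi11_compl_𝒰_inter, ?_⟩,
    fun S => boldDelta11_iff_measurableSet⟩
  · ext S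
    constructor
    · rintro ⟨K, rfl⟩
      exact hsec K
    · intro hS
      obtain ⟨K, -, h⟩ := exists_solid_of_analyticSet hS
      exact ⟨K, h.symm⟩
  · rw [LightPi11, compl_compl]
    exact lightSigma11_𝒰
  · show AnalyticSet (𝒰ᶜ)ᶜ
    rwa [compl_compl]
  · ext S
    constructor
    · rintro ⟨K, rfl⟩
      exact hcosec K
    · intro hS
      obtain ⟨K, -, h⟩ := hex S hS
      exact ⟨K, h.symm⟩
  · exact parametrizes_iff.2 ⟨fun K _ => hsec K, fun S hS => exists_solid_of_analyticSet hS⟩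
  · exact parametrizes_iff.2 ⟨fun K _ => hcosec K, hex⟩
  · refine parametrizes_iff.2 ⟨fun K hK => ?_, fun S hS => ?_⟩
    · exact boldDelta11_iff_measurableSet.2 (measurableSet_vsection hK)
    · exact exists_solid_injective_of_measurableSet (boldDelta11_iff_measurableSet.1 hS)
  · refine parametrizes_iff.2 ⟨fun K hK => ?_, fun S hS => ?_⟩
    · exact boldDelta11_iff_measurableSet.2 (measurableSet_vsection hK).compl
    · obtain ⟨K, hK, h⟩ :=
        exists_solid_injective_of_measurableSet (boldDelta11_iff_measurableSet.1 hS).compl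
      exact ⟨K, hK, by rw [vsection_compl, h, compl_compl]⟩
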